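/- **Setting.** Norms are Euclidean/spectral. Let $A\in\mathbb R^{m\times n}$, $L\in\mathbb R^{p\times n}$ with $\operatorname{rank}\binom{A}{L}=n$, and let $\binom{A}{L}=QR$ be an economy QR factorization ($Q^{\mathrm T}Q=I_n$, $R$ upper triangular). Floating point arithmetic with unit roundoff $\epsilon\in(0,1/2]$ follows the standard model: each scalar operation returns its exact result times $1+\delta$ with $|\delta|\le\epsilon$ (changes of sign are exact, sums may be formed in any order). Fix $k\ge 1$ and $\eta\ge 0$. The $k$-step joint bidiagonalization (JBD) process of $\{A,L\}$ starts from a vector $u_1\in\mathbb R^m$ of norm 1 and computes, each scalar on a left-hand side being a norm that normalizes the vector next to it, $$\alpha_1v_1'=g_1,\qquad \hat\alpha_1\hat u_1=v_1'(m+1:m+p),$$ and for $i=1,\dots,k$ $$\beta_{i+1}u_{i+1}=v_i'(1:m)-\alpha_iu_i,\quad \alpha_{i+1}v_{i+1}'=g_{i+1}-\beta_{i+1}v_i',\quad \hat\beta_i=(\alpha_{i+1}\beta_{i+1})/\hat\alpha_i,$$ $$\hat\alpha_{i+1}\hat u_{i+1}=(-1)^iv_{i+1}'(m+1:m+p)-\hat\beta_i\hat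 u_i,$$ where $g_i=\binom{A}{L}\tilde x_i$ and $\tilde x_i$ solves the inner least squares problem $\min_x\left\|\binom{A}{L}x-\binom{u_i}{0}\right\|$. In finite precision all these operations are rounded, the inner problems are solved accurately in the sense that $g_i$ is obtained with an error of norm at most $\eta\epsilon$, and $|\|u_1\|-1|\le\eta\epsilon$. From now on all symbols denote computed quantities. Let $B_k\in\mathbb R^{(k+1)\times k}$ be lower bidiagonal with diagonal $\alpha_1,\dots,\alpha_k$ and subdiagonal $\beta_2,\dots,\beta_{k+1}$, let $\underline B_k$ be its leading $k\times k$ submatrix, let $\widehat B_k\in\mathbb R^{k\times k}$ be upper bidiagonal with diagonal $\hat\alpha_1,\dots,\hat\alpha_k$ and superdiagonal $\hat\beta_1,\dots,\hat\beta_{k-1}$, and let $\bar B_k=\widehat B_k\operatorname{diag}(1,-1,\dots,(-1)^{k-1})$, $\bar\beta_k=(-1)^k\hat\beta_k$. Suppose there is no breakdown before step $k$: $\alpha_i,\hat\alpha_i\ne0$ for $1\le i\le k$ and $\beta_i\neq0$ for $2\le i\le k$. Let $$B_k\approx P_k\,\mathrm{diag}(c_1^{(k)},\dots,c_k^{(k)})\,W_k^{\mathrm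 T},\qquad \bar B_k\approx\bar P_k\,\mathrm{diag}(s_1^{(k)},\dots,s_k^{(k)})\,W_k^{\mathrm T},\qquad c_i^{(k)},s_i^{(k)}>0,$$ be computed SVDs with a common right factor, with columns $p_i^{(k)},\bar p_i^{(k)},w_i^{(k)}$ of $P_k,\bar P_k,W_k$: the first decomposition, $P_k^{\mathrm T}P_k=I$ and $W_k^{\mathrm T}W_k=I$ hold up to errors of norm at most $\eta\epsilon$; the second decomposition, $\bar P_k^{\mathrm T}\bar P_k=I$ and $(c_i^{(k)})^2+(s_i^{(k)})^2=1$ hold up to errors of norm at most $\eta(1+\|\underline B_k^{-1}\|)\epsilon$. With $U_{k+1}=(u_1,\dots,u_{k+1})$, $V_k'=(v_1',\dots,v_k')$, $\widehat U_k=(\hat u_1,\dots,\hat u_k)$, $V_k=Q^{\mathrm T}V_k'$ put $x_i^{(k)}=R^{-1}V_kw_i^{(k)}$, $y_i^{(k)}=U_{k+1}p_i^{(k)}$, $z_i^{(k)}=\widehat U_k\bar p_i^{(k)}$, and $$r_i^{(k)}=\begin{pmatrix}Ax_i^{(k)}-c_i^{(k)}y_i^{(k)}\\ Lx_i^{(k)}-s_i^{(k)}z_i^{(k)}\\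 s_i^{(k)}A^{\mathrm T}y_i^{(k)}-c_i^{(k)}L^{\mathrm T}z_i^{(k)}\end{pmatrix}.$$ **Theorem.** For all $m,n,p,k$ with $k\ge1$, all $\eta\ge 0$ and $\rho>0$ there is a constant $C>0$, depending on nothing else, such that in the setting above, whenever $\|R\|\ge\rho$, for all $i=1,\dots,k$: $$\|r_i^{(k)}\|\le\|R\|\left(\left|s_i^{(k)}\alpha_{k+1}e_{k+1}^{\mathrm T}p_i^{(k)}-c_i^{(k)}\bar\beta_ke_k^{\mathrm T}\bar p_i^{(k)}\right|+C\,\|\underline B_k^{-1}\|\|\widehat B_k^{-1}\|\,\epsilon\right),$$ $$\|r_i^{(k)}\|\le\|R\|\left(\left|\frac{\alpha_{k+1}\beta_{k+1}}{c_i^{(k)}s_i^{(k)}}e_k^{\mathrm T}w_i^{(k)}\right|+C\,\|\underline B_k^{-1}\|\|\widehat B_k^{-1}\|\,\epsilon\right).$$ -/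

import Mathlib

open Matrix
open scoped Matrix.Norms.L2Operator

noncomputable section

/-! Matrix norms below are spectral norms (the `L2Operator` scope); the Euclidean norm of a vector
`x : ι → ℝ` is written `‖WithLp.toLp 2 x‖`. Indices of the scalars and vectors of the joint
bidiagonalization (JBD) process start at `1`. -/

namespace JBD

/-! ### The standard model of floating point arithmetic -/

/-- `y` is an admissible floating point result of an operation whose exact result is `z`, for
the unit roundoff `ε`: `y = z (1 + δ)` with `|δ| ≤ ε`. -/
def Fl (ε y z : ℝ) : Prop := |y - z| ≤ ε * |z|

/-- `FlSum ε s a`: the terms in `s` can be added up, two partial sums at a time and in some order,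
with the computed result `a`. -/
inductive FlSum (ε : ℝ) : Multiset ℝ → ℝ → Prop
  | nil : FlSum ε 0 0
  | single (a : ℝ) : FlSum ε {a} a
  | add {s t : Multiset ℝ} {a b c : ℝ} (hs : s ≠ 0) (ht : t ≠ 0)
      (ha : FlSum ε s a) (hb : FlSum ε t b) (hc : Fl ε c (a + b)) : FlSum ε (s + t) c

/-- `ν` is a computed Euclidean norm of `x`: entries are squared, summed in any order, and a
square root is taken, each operation being rounded. -/
def FlNorm {ι : Type} [Fintype ι] (ε : ℝ) (x : ι → ℝ) (ν : ℝ) : Prop :=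
  ∃ (sq : ι → ℝ) (σ : ℝ), (∀ j, Fl ε (sq j) (x j * x j)) ∧
    FlSum ε (Finset.univ.val.map sq) σ ∧ Fl ε ν (Real.sqrt σ)

/-- `r` is a computed value of the vector `a - t b`. -/
def FlSubSmul {ι : Type} (ε : ℝ) (r a : ι → ℝ) (t : ℝ) (b : ι → ℝ) : Prop :=
  ∀ j, ∃ w, Fl ε w (t * b j) ∧ Fl ε (r j) (a j - w)

/-- `ν` and `y` are computed by normalizing `r`, that is, from `ν y = r` with `‖y‖ = 1`. -/
def FlNormalize {ι : Type} [Fintype ι] (ε : ℝ) (r : ι → ℝ) (ν : ℝ) (y : ι → ℝ) : Prop :=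
  FlNorm ε r ν ∧ ∀ j, Fl ε (y j) (r j / ν)

/-! ### The pair of matrices -/

/-- `{A, L}` is a regular pair, and `Q R` is an economy QR factorization of the stacked matrix. -/
structure IsRegularQR {m n p : ℕ} (A : Matrix (Fin m) (Fin n) ℝ) (L : Matrix (Fin p) (Fin n) ℝ)
    (Q : Matrix (Fin m ⊕ Fin p) (Fin n) ℝ) (R : Matrix (Fin n) (Fin n) ℝ) : Prop where
  regular : (fromRows A L).rank = n
  factor : fromRows A L = Q * R
  orthonormal : Qᵀ * Q = 1
  upper : R.BlockTriangular id

/-- `x` minimizes `‖(A; L) x - b‖`. -/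
def IsLeastSquaresSol {m n p : ℕ} (A : Matrix (Fin m) (Fin n) ℝ) (L : Matrix (Fin p) (Fin n) ℝ)
    (b : Fin m ⊕ Fin p → ℝ) (x : Fin n → ℝ) : Prop :=
  IsMinOn (fun y => ‖WithLp.toLp 2 (fromRows A L *ᵥ y - b)‖) Set.univ x

/-- `g` is the vector `(A; L) x̃`, up to a normwise error of at most `δ`, where `x̃` solves the
least squares problem with the right-hand side `(u; 0)`; so `g` is, up to `δ`, the orthogonal
projection `Q Qᵀ (u; 0)`. -/
def AccurateProjection {m n p : ℕ} (A : Matrix (Fin m) (Fin n) ℝ)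
    (L : Matrix (Fin p) (Fin n) ℝ) (δ : ℝ) (u : Fin m → ℝ) (g : Fin m ⊕ Fin p → ℝ) : Prop :=
  ∃ x : Fin n → ℝ, IsLeastSquaresSol A L (Sum.elim u 0) x ∧
    ‖WithLp.toLp 2 (g - fromRows A L *ᵥ x)‖ ≤ δ

/-! ### The JBD process in finite precision -/

/-- The scalars `α, β, α̂, β̂` and the vectors `u, v', û` of a JBD process. -/
structure Data (m p : ℕ) where
  α : ℕ → ℝ
  β : ℕ → ℝ
  αh : ℕ → ℝ
  βh : ℕ → ℝ
  u : ℕ → Fin m → ℝ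
  v : ℕ → Fin m ⊕ Fin p → ℝ
  uh : ℕ → Fin p → ℝ

/-- `X` is the output of the `k`-step JBD process of `{A, L}` in floating point arithmetic with
unit roundoff `ε`; the starting vector is normalized, and the inner least squares problems are
solved, to within `η ε`. Changes of sign are exact. -/
structure IsComputed {m n p : ℕ} (A : Matrix (Fin m) (Fin n) ℝ) (L : Matrix (Fin p) (Fin n) ℝ)
    (k : ℕ) (η ε : ℝ) (X : Data m p) : Prop where
  start : |‖WithLp.toLp 2 (X.u 1)‖ - 1| ≤ η * ε
  v_one : ∃ g, AccurateProjection A L (η * ε) (X.u 1) g ∧ FlNormalize ε g (X.α 1) (X.v 1)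
  uh_one : FlNormalize ε (fun j => X.v 1 (Sum.inr j)) (X.αh 1) (X.uh 1)
  u_step : ∀ i, 1 ≤ i → i ≤ k → ∃ r : Fin m → ℝ,
    FlSubSmul ε r (fun j => X.v i (Sum.inl j)) (X.α i) (X.u i) ∧
      FlNormalize ε r (X.β (i + 1)) (X.u (i + 1))
  v_step : ∀ i, 1 ≤ i → i ≤ k → ∃ g r : Fin m ⊕ Fin p → ℝ,
    AccurateProjection A L (η * ε) (X.u (i + 1)) g ∧
      FlSubSmul ε r g (X.β (i + 1)) (X.v i) ∧ FlNormalize ε r (X.α (i + 1)) (X.v (i + 1))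
  βh_step : ∀ i, 1 ≤ i → i ≤ k → ∃ t : ℝ,
    Fl ε t (X.α (i + 1) * X.β (i + 1)) ∧ Fl ε (X.βh i) (t / X.αh i)
  uh_step : ∀ i, 1 ≤ i → i ≤ k → ∃ r : Fin p → ℝ,
    FlSubSmul ε r (fun j => (-1) ^ i * X.v (i + 1) (Sum.inr j)) (X.βh i) (X.uh i) ∧
      FlNormalize ε r (X.αh (i + 1)) (X.uh (i + 1))

namespace Data

variable {m p : ℕ} (X : Data m p) (k : ℕ)

/-- The process does not break down before step `k`. -/
def NoBreakdown : Prop :=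
  (∀ i, 1 ≤ i → i ≤ k → X.α i ≠ 0 ∧ X.αh i ≠ 0) ∧ ∀ i, 2 ≤ i → i ≤ k → X.β i ≠ 0

/-- `B_k`, lower bidiagonal with diagonal `α_1, …, α_k` and subdiagonal `β_2, …, β_{k+1}`. -/
def B : Matrix (Fin (k + 1)) (Fin k) ℝ := fun i j =>
  if (i : ℕ) = j then X.α (j + 1) else if (i : ℕ) = j + 1 then X.β (j + 2) else 0

/-- The leading `k × k` principal submatrix of `B_k`. -/
def Bunder : Matrix (Fin k) (Fin k) ℝ := (X.B k).submatrix Fin.castSucc id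

/-- `B̂_k`, upper bidiagonal with diagonal `α̂_1, …, α̂_k` and superdiagonal
`β̂_1, …, β̂_{k-1}`. -/
def Bhat : Matrix (Fin k) (Fin k) ℝ := fun i j =>
  if (i : ℕ) = j then X.αh (i + 1) else if (j : ℕ) = i + 1 then X.βh (i + 1) else 0

/-- `B̄_k = B̂_k D_k` with `D_k = diag(1, -1, …, (-1)^{k-1})`. -/
def Bbar : Matrix (Fin k) (Fin k) ℝ := X.Bhat k * diagonal fun j : Fin k => (-1 : ℝ) ^ (j : ℕ)

/-- `β̄_k = (-1)^k β̂_k`. -/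
def βbar : ℝ := (-1) ^ k * X.βh k

/-- `U_{k+1} = (u_1, …, u_{k+1})`. -/
def U : Matrix (Fin m) (Fin (k + 1)) ℝ := fun a j => X.u (j + 1) a

/-- `V'_k = (v'_1, …, v'_k)`. -/
def V : Matrix (Fin m ⊕ Fin p) (Fin k) ℝ := fun a j => X.v (j + 1) a

/-- `Û_k = (û_1, …, û_k)`. -/
def Uhat : Matrix (Fin p) (Fin k) ℝ := fun a j => X.uh (j + 1) a

end Data

/-! ### The JBD method -/

/-- `B = P Θ Wᵀ` and `B̄ = P̄ Ψ Wᵀ` are computed singular value decompositions with a common right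
factor, `Θ = diag(c_1, …, c_k)` and `Ψ = diag(s_1, …, s_k)`. The decomposition of `B` holds, and
`P`, `W` have orthonormal columns, to within `δ`; the decomposition of `B̄` with the same `W`, the
orthogonality of `P̄` and the normalization `c_i² + s_i² = 1` hold to within `δ'`. (Exactly, they
hold together only if `Bᵀ B + B̄ᵀ B̄ = I`, which is perturbed by rounding.) -/
structure IsComputedGSVD {k : ℕ} (B : Matrix (Fin (k + 1)) (Fin k) ℝ)
    (Bbar : Matrix (Fin k) (Fin k) ℝ) (δ δ' : ℝ) (c s : Fin k → ℝ)
    (P : Matrix (Fin (k + 1)) (Fin k) ℝ) (Pbar W : Matrix (Fin k) (Fin k) ℝ) : Prop where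
  pos_c : ∀ i, 0 < c i
  pos_s : ∀ i, 0 < s i
  svd_B : ‖B - P * diagonal c * Wᵀ‖ ≤ δ
  svd_Bbar : ‖Bbar - Pbar * diagonal s * Wᵀ‖ ≤ δ'
  orth_P : ‖Pᵀ * P - 1‖ ≤ δ
  orth_Pbar : ‖Pbarᵀ * Pbar - 1‖ ≤ δ'
  orth_W : ‖Wᵀ * W - 1‖ ≤ δ
  normalized : ∀ i, |c i ^ 2 + s i ^ 2 - 1| ≤ δ'

/-- The residual of the approximate GSVD component `(c, s, x, y, z)` of `{A, L}`. -/
def residual {m n p : ℕ} (A : Matrix (Fin m) (Fin n) ℝ) (L : Matrix (Fin p) (Fin n) ℝ)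
    (c s : ℝ) (x : Fin n → ℝ) (y : Fin m → ℝ) (z : Fin p → ℝ) : Fin m ⊕ Fin p ⊕ Fin n → ℝ :=
  Sum.elim (A *ᵥ x - c • y)
    (Sum.elim (L *ᵥ x - s • z) (s • (Aᵀ *ᵥ y) - c • (Lᵀ *ᵥ z)))

/-- The residual of the approximate GSVD component that the JBD method obtains from `c`, `s`
and the vectors `w`, `q`, `qbar` (the columns of `W`, `P`, `P̄`): `x = R⁻¹ V_k w`, `y = U_{k+1} q`
and `z = Û_k qbar`. Here `V_k = Qᵀ V'_k`, so that `x` is the exact least squares solution of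
`(A; L) x = V'_k w`. -/
def jbdResidual {m n p : ℕ} (A : Matrix (Fin m) (Fin n) ℝ) (L : Matrix (Fin p) (Fin n) ℝ)
    (Q : Matrix (Fin m ⊕ Fin p) (Fin n) ℝ) (R : Matrix (Fin n) (Fin n) ℝ) (X : Data m p) (k : ℕ)
    (c s : ℝ) (w : Fin k → ℝ) (q : Fin (k + 1) → ℝ) (qbar : Fin k → ℝ) :
    Fin m ⊕ Fin p ⊕ Fin n → ℝ :=
  residual A L c s (R⁻¹ *ᵥ ((Qᵀ * X.V k) *ᵥ w)) (X.U k *ᵥ q) (X.Uhat k *ᵥ qbar)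

end JBD

end

open Matrix
open scoped Matrix.Norms.L2Operator

noncomputable section

open Asymptotics Filter Topology

namespace JBD

/-! ### Rounding errors of normalized vectors -/

/-! Write `κ = ‖B̲_k⁻¹‖`, `κ̂ = ‖B̂_k⁻¹‖`, `θ = κ κ̂ ε`, and split `Q` into row blocks `Q_A`, `Q_L`,
so that `A = Q_A R`, `L = Q_L R`. Since `R R⁻¹` cancels, the first two blocks of the residual do not
involve `R`, and the third is `Rᵀ` times a vector; `ρ ≤ ‖R‖` lets the first two be charged to `‖R‖`
as well.

Uniformity: all data of a run form one point of the type `Run`, and "there is a constant depending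
only on the dimensions, `η` and `ρ`" becomes an `O` estimate along a filter on `Run`. For `θ ≥ δ`
the crude bound `O(1 + κ ε)` on the blocks suffices, because it is `O(θ)` there. The analysis
concerns `θ → 0`.

Up to `O(ε)` the recurrences read `V' Bᵀ + α_{k+1} v'_{k+1} e_{k+1}ᵀ = Q Qᵀ (U; 0)`, `V'_A = U B`,
`V'_L = Û B̄`. Inverting `B̲_k` in the first gives `(1 - Q Qᵀ) V' = O(κ ε)` (`one_sub_proj_mul_V`),
so with `V = Qᵀ V'` one gets `Q_A V = U B` and `Q_L V = Û B̄` up to `O(κ ε)`; combined with the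
computed decompositions this makes the first two blocks `O(θ)`.

For the third block, `Q_Aᵀ U = V Bᵀ + α_{k+1} q e_{k+1}ᵀ` with `q = Qᵀ v'_{k+1}`. The analogue `Q_Lᵀ
Û = V B̄ᵀ + β̄_k q e_kᵀ` (`QL_transpose_mul_Uhat`) follows from `Q_Aᵀ Q_A + Q_Lᵀ Q_L = 1` and `Bᵀ B
+ B̄ᵀ B̄ = 1 + O(κ ε)` (`gram_isBigO`), after cancelling `B̄` on the right at the price of `κ̂`.
Hence the third block is `Rᵀ` applied to a multiple of `q`, up to `O(θ)`, and the multiplier is the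
first coefficient. It agrees with the second one up to `O(θ)` by the last rows of `B W ≈ P Θ` and
`B̄ W ≈ P̄ Ψ`. Coefficient exactly 1 in the bounds comes from `‖q‖ ≤ 1 + O(ε)` and boundedness of
the multiplier, which requires `β̂_k = O(1)` (`βh_last_isBigO_one`). -/

/-- Every addition costs one factor `1 ± ε`. Both summands of an addition are nonempty, so each has
fewer terms than the union; hence one factor per term is enough in any order of summation. -/
theorem FlSum.bounds {ε : ℝ} (h0 : 0 ≤ ε) (h1 : ε ≤ 1) {s : Multiset ℝ} {a : ℝ}
    (h : FlSum ε s a) (hs : ∀ x ∈ s, 0 ≤ x) :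
    (1 - ε) ^ s.card * s.sum ≤ a ∧ a ≤ (1 + ε) ^ s.card * s.sum := by
  induction h with
  | nil => simp
  | single a =>
    have : 0 ≤ a := hs a (by simp)
    simp only [Multiset.card_singleton, pow_one, Multiset.sum_singleton]
    constructor <;> nlinarith
  | @add s t a b c hs0 ht0 _ _ hc iha ihb =>
    obtain ⟨ha1, ha2⟩ := iha fun x hx => hs x (by simp [hx])
    obtain ⟨hb1, hb2⟩ := ihb fun x hx => hs x (by simp [hx])
    have hsS : 0 ≤ s.sum := Multiset.sum_nonneg fun x hx => hs x (by simp [hx])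
    have htS : 0 ≤ t.sum := Multiset.sum_nonneg fun x hx => hs x (by simp [hx])
    have hsc : 1 ≤ s.card := Multiset.card_pos.2 hs0
    have htc : 1 ≤ t.card := Multiset.card_pos.2 ht0
    have e0 : (0 : ℝ) ≤ 1 - ε := by linarith
    have ha0 : 0 ≤ a := le_trans (by positivity) ha1
    have hb0 : 0 ≤ b := le_trans (by positivity) hb1
    rw [Multiset.card_add, Multiset.sum_add]
    unfold Fl at hc
    rw [abs_of_nonneg (add_nonneg ha0 hb0), abs_le] at hc
    have pw : ∀ i j : ℕ, i + 1 ≤ j → (1 - ε) ^ j ≤ (1 - ε) * (1 - ε) ^ i ∧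
        (1 + ε) * (1 + ε) ^ i ≤ (1 + ε) ^ j := fun i j hij => by
      rw [← pow_succ', ← pow_succ']
      exact ⟨pow_le_pow_of_le_one e0 (by linarith) hij,
        pow_le_pow_right₀ (by linarith) hij⟩
    have p1 := pw s.card (s.card + t.card) (by omega)
    have p2 := pw t.card (s.card + t.card) (by omega)
    constructor
    · have q1 := mul_le_mul_of_nonneg_right p1.1 hsS
      have q2 := mul_le_mul_of_nonneg_right p2.1 htS
      have q3 := mul_le_mul_of_nonneg_left ha1 e0
      have q4 := mul_le_mul_of_nonneg_left hb1 e0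
      nlinarith
    · have q1 := mul_le_mul_of_nonneg_right p1.2 hsS
      have q2 := mul_le_mul_of_nonneg_right p2.2 htS
      have e1 : 0 ≤ 1 + ε := by linarith
      have q3 := mul_le_mul_of_nonneg_left ha2 e1
      have q4 := mul_le_mul_of_nonneg_left hb2 e1
      nlinarith

theorem Fl.bounds_of_nonneg {ε y z : ℝ} (h : Fl ε y z) (hz : 0 ≤ z) :
    (1 - ε) * z ≤ y ∧ y ≤ (1 + ε) * z := by
  unfold Fl at h
  rw [abs_of_nonneg hz, abs_le] at h
  constructor <;> linarith

theorem Fl.sq_bounds {ε y z : ℝ} (h1 : ε ≤ 1) (h : Fl ε y z) :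
    (1 - ε) ^ 2 * z ^ 2 ≤ y ^ 2 ∧ y ^ 2 ≤ (1 + ε) ^ 2 * z ^ 2 := by
  unfold Fl at h
  have a1 : |y| ≤ (1 + ε) * |z| := by
    calc |y| = |(y - z) + z| := by ring_nf
      _ ≤ |y - z| + |z| := abs_add_le _ _
      _ ≤ _ := by linarith
  have a2 : (1 - ε) * |z| ≤ |y| := by
    have : |z| ≤ |z - y| + |y| := by
      calc |z| = |(z - y) + y| := by ring_nf
        _ ≤ _ := abs_add_le _ _
    rw [abs_sub_comm] at this
    linarith
  rw [← sq_abs y, ← sq_abs z, ← mul_pow, ← mul_pow]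
  exact ⟨pow_le_pow_left₀ (mul_nonneg (by linarith) (abs_nonneg _)) a2 2,
    pow_le_pow_left₀ (abs_nonneg _) a1 2⟩

theorem norm_toLp_sq {ι : Type*} [Fintype ι] (x : ι → ℝ) :
    ‖WithLp.toLp 2 x‖ ^ 2 = ∑ j, x j ^ 2 := by
  rw [EuclideanSpace.real_norm_sq_eq]

/-- The exponent counts one rounding for the squares, one per term for the sum, and two for the
rounding of the root, which is squared here. -/
theorem FlNorm.bounds {ι : Type} [Fintype ι] {ε : ℝ} (h0 : 0 ≤ ε) (h1 : ε ≤ 1) {x : ι → ℝ}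
    {ν : ℝ} (h : FlNorm ε x ν) : 0 ≤ ν ∧
      (1 - ε) ^ (Fintype.card ι + 3) * ‖WithLp.toLp 2 x‖ ^ 2 ≤ ν ^ 2 ∧
      ν ^ 2 ≤ (1 + ε) ^ (Fintype.card ι + 3) * ‖WithLp.toLp 2 x‖ ^ 2 := by
  obtain ⟨sq, σ, hsq, hσ, hν⟩ := h
  have e0 : (0 : ℝ) ≤ 1 - ε := by linarith
  have hb : ∀ j, (1 - ε) * x j ^ 2 ≤ sq j ∧ sq j ≤ (1 + ε) * x j ^ 2 := fun j => by
    have := (hsq j).bounds_of_nonneg (mul_self_nonneg _)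
    rw [← pow_two] at this
    exact this
  have hsq0 : ∀ j, 0 ≤ sq j := fun j => le_trans (by positivity) (hb j).1
  have hS := hσ.bounds h0 h1 (by simpa using hsq0)
  simp only [Multiset.card_map, Finset.card_val, Finset.card_univ] at hS
  change _ * (∑ j, sq j) ≤ _ ∧ _ ≤ _ * (∑ j, sq j) at hS
  have s1 : (1 - ε) * ∑ j, x j ^ 2 ≤ ∑ j, sq j := by
    rw [Finset.mul_sum]; exact Finset.sum_le_sum fun j _ => (hb j).1
  have s2 : ∑ j, sq j ≤ (1 + ε) * ∑ j, x j ^ 2 := by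
    rw [Finset.mul_sum]; exact Finset.sum_le_sum fun j _ => (hb j).2
  have hσ0 : 0 ≤ σ := le_trans
    (mul_nonneg (by positivity) (Finset.sum_nonneg fun j _ => hsq0 j)) hS.1
  have hν' := Fl.sq_bounds h1 hν
  rw [Real.sq_sqrt hσ0] at hν'
  refine ⟨le_trans (by positivity) (hν.bounds_of_nonneg (Real.sqrt_nonneg _)).1, ?_, ?_⟩
  · rw [norm_toLp_sq]
    calc (1 - ε) ^ (Fintype.card ι + 3) * ∑ j, x j ^ 2
        = (1 - ε) ^ 2 * ((1 - ε) ^ Fintype.card ι * ((1 - ε) * ∑ j, x j ^ 2)) := by ring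
      _ ≤ (1 - ε) ^ 2 * ((1 - ε) ^ Fintype.card ι * ∑ j, sq j) := by gcongr
      _ ≤ (1 - ε) ^ 2 * σ := by gcongr; exact hS.1
      _ ≤ ν ^ 2 := hν'.1
  · rw [norm_toLp_sq]
    calc ν ^ 2 ≤ (1 + ε) ^ 2 * σ := hν'.2
      _ ≤ (1 + ε) ^ 2 * ((1 + ε) ^ Fintype.card ι * ∑ j, sq j) := by gcongr; exact hS.2
      _ ≤ (1 + ε) ^ 2 * ((1 + ε) ^ Fintype.card ι * ((1 + ε) * ∑ j, x j ^ 2)) := by gcongr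
      _ = _ := by ring

theorem le_of_sq_le_sq_of_nonneg {a b : ℝ} (h : a ^ 2 ≤ b ^ 2) (hb : 0 ≤ b) : a ≤ b :=
  (le_abs_self a).trans (abs_le_of_sq_le_sq h hb)

/-- The right-hand side is the chord over `[0, 1]` of the convex function on the left. -/
theorem one_add_pow_le {x : ℝ} (h0 : 0 ≤ x) (h1 : x ≤ 1) (N : ℕ) :
    (1 + x) ^ N ≤ 1 + (2 ^ N - 1) * x := by
  induction N with
  | zero => simp
  | succ N ih =>
    have h2 : (1 : ℝ) ≤ 2 ^ N := one_le_pow₀ (by norm_num)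
    calc (1 + x) ^ (N + 1) = (1 + x) ^ N * (1 + x) := pow_succ _ _
      _ ≤ (1 + (2 ^ N - 1) * x) * (1 + x) := by gcongr
      _ ≤ _ := by
        rw [pow_succ]
        nlinarith [mul_nonneg (mul_nonneg (sub_nonneg.2 h2) h0) (sub_nonneg.2 h1)]

/-- The lower bound on `‖y‖` has to exclude `ν = 0`: then `r = 0`, and division by zero returns `y =
0`. -/
theorem FlNormalize.bounds (ι : Type) [Fintype ι] : ∃ K : ℝ, 0 < K ∧
    ∀ (ε : ℝ), 0 < ε → ε ≤ 1 / 2 → ∀ (r : ι → ℝ) (ν : ℝ) (y : ι → ℝ), FlNormalize ε r ν y →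
      |ν| ≤ K * ‖WithLp.toLp 2 r‖ ∧ (∀ j, |ν * y j - r j| ≤ ε * |r j|) ∧
      ‖WithLp.toLp 2 y‖ ≤ 1 + K * ε ∧ (ν ≠ 0 → 1 - K * ε ≤ ‖WithLp.toLp 2 y‖) := by
  set M := Fintype.card ι + 3 with hM
  -- This value dominates all constants met below: `2 ^ M`, `2 ^ (M + 2)` and `M + 2`.
  refine ⟨2 ^ (2 * (M + 2)), by positivity, fun ε h0 h1 r ν y h => ?_⟩
  obtain ⟨hn, hy⟩ := h
  obtain ⟨hν0, hν1, hν2⟩ := hn.bounds h0.le (by linarith)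
  rw [← hM] at hν1 hν2
  have e0 : 0 < 1 - ε := by linarith
  have hK1 : (1 : ℝ) ≤ 2 ^ (2 * (M + 2)) := one_le_pow₀ (by norm_num)
  have hrz : ν = 0 → ‖WithLp.toLp 2 r‖ = 0 := fun hz => by
    rw [hz] at hν1
    have : 0 < (1 - ε) ^ M := by positivity
    have h3 : ‖WithLp.toLp 2 r‖ ^ 2 ≤ 0 := by
      by_contra hc
      push Not at hc
      nlinarith [mul_pos this hc]
    exact pow_eq_zero_iff (two_ne_zero) |>.1 (le_antisymm h3 (sq_nonneg _))
  have hrz' : ν = 0 → r = 0 := fun hz => by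
    have := norm_eq_zero.1 (hrz hz)
    simpa using this
  refine ⟨?_, fun j => ?_, ?_, fun hne => ?_⟩
  · rw [abs_of_nonneg hν0]
    refine le_of_sq_le_sq_of_nonneg ?_ (by positivity)
    calc ν ^ 2 ≤ (1 + ε) ^ M * ‖WithLp.toLp 2 r‖ ^ 2 := hν2
      _ ≤ 2 ^ M * ‖WithLp.toLp 2 r‖ ^ 2 := by gcongr; linarith
      _ ≤ (2 ^ (2 * (M + 2))) ^ 2 * ‖WithLp.toLp 2 r‖ ^ 2 := by
        gcongr
        rw [← pow_mul]
        exact pow_le_pow_right₀ (by norm_num) (by omega)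
      _ = _ := by ring
  · by_cases hz : ν = 0
    · simp [hz, hrz' hz]
    · have := hy j
      unfold Fl at this
      have e : ν * y j - r j = ν * (y j - r j / ν) := by field_simp
      rw [e, abs_mul]
      calc |ν| * |y j - r j / ν| ≤ |ν| * (ε * |r j / ν|) := by gcongr
        _ = ε * |r j| := by rw [abs_div]; field_simp
  · by_cases hz : ν = 0
    · have : y = 0 := by
        ext j
        have := hy j
        simpa [Fl, hz] using this
      rw [this]; simp; positivity
    · have hνp : 0 < ν ^ 2 := by positivity
      have hs : ‖WithLp.toLp 2 y‖ ^ 2 ≤ (1 + ε) ^ 2 * (‖WithLp.toLp 2 r‖ ^ 2 / ν ^ 2) := by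
        rw [norm_toLp_sq, norm_toLp_sq, Finset.sum_div, Finset.mul_sum]
        refine Finset.sum_le_sum fun j _ => ?_
        simpa [div_pow] using (Fl.sq_bounds (by linarith) (hy j)).2
      have hq : ‖WithLp.toLp 2 r‖ ^ 2 / ν ^ 2 ≤ (1 + 2 * ε) ^ M := by
        rw [div_le_iff₀ hνp]
        -- Here `ε ≤ 1/2` enters: `(1 + 2ε)(1 - ε) = 1 + ε(1 - 2ε)`.
        have h4 : 1 ≤ (1 + 2 * ε) ^ M * (1 - ε) ^ M := by
          rw [← mul_pow]; exact one_le_pow₀ (by nlinarith)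
        nlinarith [mul_le_mul_of_nonneg_left hν1 (show 0 ≤ (1 + 2 * ε) ^ M by positivity),
          mul_le_mul_of_nonneg_right h4 (sq_nonneg ‖WithLp.toLp 2 r‖)]
      have h5 : ‖WithLp.toLp 2 y‖ ^ 2 ≤ 1 + 2 ^ (M + 2) * (2 * ε) := by
        calc _ ≤ (1 + ε) ^ 2 * (1 + 2 * ε) ^ M := hs.trans (by gcongr)
          _ ≤ (1 + 2 * ε) ^ 2 * (1 + 2 * ε) ^ M := by gcongr; linarith
          _ = (1 + 2 * ε) ^ (M + 2) := by ring
          _ ≤ _ := (one_add_pow_le (by positivity) (by linarith) _).trans (by nlinarith)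
      refine le_of_sq_le_sq_of_nonneg (h5.trans ?_) (by positivity)
      have : (2 : ℝ) ^ (M + 2) ≤ 2 ^ (2 * (M + 2)) := pow_le_pow_right₀ (by norm_num) (by omega)
      nlinarith [sq_nonneg ((2 : ℝ) ^ (2 * (M + 2)) * ε)]
  -- If `K ε ≥ 1`, the asserted lower bound is not positive.
  · by_cases hbig : 1 ≤ 2 ^ (2 * (M + 2)) * ε
    · exact le_trans (by linarith) (norm_nonneg _)
    push Not at hbig
    have hνp : 0 < ν ^ 2 := by positivity
    have hs : (1 - ε) ^ 2 * (‖WithLp.toLp 2 r‖ ^ 2 / ν ^ 2) ≤ ‖WithLp.toLp 2 y‖ ^ 2 := by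
      rw [norm_toLp_sq, norm_toLp_sq, Finset.sum_div, Finset.mul_sum]
      refine Finset.sum_le_sum fun j _ => ?_
      simpa [div_pow] using (Fl.sq_bounds (by linarith) (hy j)).1
    have hq : (1 - ε) ^ M ≤ ‖WithLp.toLp 2 r‖ ^ 2 / ν ^ 2 := by
      rw [le_div_iff₀ hνp]
      have h4 : (1 - ε) ^ M * (1 + ε) ^ M ≤ 1 := by
        rw [← mul_pow]; exact pow_le_one₀ (by nlinarith) (by nlinarith)
      nlinarith [mul_le_mul_of_nonneg_left hν2 (show 0 ≤ (1 - ε) ^ M by positivity),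
        mul_le_mul_of_nonneg_right h4 (sq_nonneg ‖WithLp.toLp 2 r‖)]
    have h6 : (1 - ε) ^ (M + 2) ≤ ‖WithLp.toLp 2 y‖ ^ 2 := by
      calc (1 - ε) ^ (M + 2) = (1 - ε) ^ 2 * (1 - ε) ^ M := by ring
        _ ≤ _ := (by gcongr : _ ≤ _).trans hs
    have h7 : 1 - ((M + 2 : ℕ) : ℝ) * ε ≤ (1 - ε) ^ (M + 2) := by
      have := one_add_mul_le_pow (show -2 ≤ -ε by linarith) (M + 2)
      simpa [sub_eq_add_neg] using this
    have h8 : ((M + 2 : ℕ) : ℝ) ≤ 2 ^ (2 * (M + 2)) := by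
      have : M + 2 ≤ 2 ^ (2 * (M + 2)) :=
        (Nat.lt_two_pow_self).le.trans (Nat.pow_le_pow_right (by norm_num) (by omega))
      exact_mod_cast this
    refine le_of_sq_le_sq_of_nonneg (le_trans ?_ (h7.trans h6)) (norm_nonneg _)
    have h9 := mul_le_mul_of_nonneg_right h8 h0.le
    have h10 : 0 ≤ 2 ^ (2 * (M + 2)) * ε := by positivity
    nlinarith [mul_nonneg h10 (sub_nonneg.2 hbig.le)]

/-! ### Asymptotic comparison of matrix valued functions -/

section BigO

variable {T : Type*} {l : Filter T}

/-- In fixed finite dimension the spectral norm is equivalent to the largest entry, so all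
comparisons of matrices may be made entry by entry. -/
theorem isBigO_matrix {ι κ : Type*} [Fintype ι] [Fintype κ] [DecidableEq ι] [DecidableEq κ]
    {f : T → Matrix ι κ ℝ} {g : T → ℝ} :
    f =O[l] g ↔ ∀ i j, (fun t => f t i j) =O[l] g := by
  constructor
  · intro h i j
    have := (LinearMap.toContinuousLinearMap (entryLinearMap ℝ ℝ i j)).isBigO_comp f l
    exact IsBigO.trans this h
  · intro h
    have e : f = fun t => ∑ i, ∑ j, f t i j • Matrix.single i j (1 : ℝ) := by
      funext t
      conv_lhs => rw [matrix_eq_sum_single (f t)]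
      simp
    rw [e]
    refine IsBigO.fun_sum fun i _ => IsBigO.fun_sum fun j _ => ?_
    have h1 : (fun _ : T => Matrix.single i j (1 : ℝ)) =O[l] fun _ => (1 : ℝ) :=
      isBigO_const_const _ one_ne_zero _
    simpa using (h i j).smul h1

theorem _root_.Asymptotics.IsBigO.matrix_mul {ι κ τ : Type*} [Fintype ι] [Fintype κ] [Fintype τ]
    [DecidableEq ι] [DecidableEq κ] [DecidableEq τ]
    {f : T → Matrix ι κ ℝ} {f' : T → Matrix κ τ ℝ} {g g' : T → ℝ}
    (h : f =O[l] g) (h' : f' =O[l] g') : (fun t => f t * f' t) =O[l] fun t => g t * g' t := by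
  rw [isBigO_matrix] at *
  intro i j
  simp only [Matrix.mul_apply]
  exact IsBigO.fun_sum fun r _ => (h i r).mul (h' r j)

theorem _root_.Asymptotics.IsBigO.matrix_mulVec {ι κ : Type*} [Fintype ι] [Fintype κ]
    [DecidableEq ι] [DecidableEq κ]
    {f : T → Matrix ι κ ℝ} {v : T → κ → ℝ} {g g' : T → ℝ}
    (h : f =O[l] g) (h' : v =O[l] g') : (fun t => f t *ᵥ v t) =O[l] fun t => g t * g' t := by
  rw [isBigO_matrix] at h
  rw [isBigO_pi] at *
  intro i
  simp only [Matrix.mulVec, dotProduct]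
  exact IsBigO.fun_sum fun r _ => (h i r).mul (h' r)

theorem _root_.Asymptotics.IsBigO.matrix_transpose {ι κ : Type*} [Fintype ι] [Fintype κ]
    [DecidableEq ι] [DecidableEq κ] {f : T → Matrix ι κ ℝ} {g : T → ℝ}
    (h : f =O[l] g) : (fun t => (f t)ᵀ) =O[l] g := by
  rw [isBigO_matrix] at *
  exact fun i j => h j i

theorem isBigO_toLp {ι : Type*} [Fintype ι] (f : T → ι → ℝ) :
    (fun t => WithLp.toLp 2 (f t)) =O[l] f :=
  (PiLp.continuousLinearEquiv 2 ℝ fun _ : ι => ℝ).symm.toContinuousLinearMap.isBigO_comp f l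

theorem isBigO_of_toLp {ι : Type*} [Fintype ι] (f : T → ι → ℝ) :
    f =O[l] (fun t => WithLp.toLp 2 (f t)) :=
  (PiLp.continuousLinearEquiv 2 ℝ fun _ : ι => ℝ).toContinuousLinearMap.isBigO_comp
    (fun t => WithLp.toLp 2 (f t)) l

theorem norm_toLp_mulVec_le {ι κ : Type*} [Fintype ι] [Fintype κ] [DecidableEq κ]
    (M : Matrix ι κ ℝ) (x : κ → ℝ) :
    ‖WithLp.toLp 2 (M *ᵥ x)‖ ≤ ‖M‖ * ‖WithLp.toLp 2 x‖ :=
  l2_opNorm_mulVec M (WithLp.toLp 2 x)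

theorem l2_opNorm_transpose {ι κ : Type*} [Fintype ι] [Fintype κ] [DecidableEq ι] [DecidableEq κ]
    (M : Matrix ι κ ℝ) : ‖Mᵀ‖ = ‖M‖ := by
  rw [← conjTranspose_eq_transpose_of_trivial, l2_opNorm_conjTranspose]

/-- The diagonal entries of `fᵀ f` are the sums of squares of the columns of `f`. -/
theorem isBigO_sq_entry {ι κ : Type*} [Fintype ι] [Fintype κ]
    [DecidableEq ι] [DecidableEq κ] {f : T → Matrix ι κ ℝ} {g : T → ℝ}
    (h : (fun t => (f t)ᵀ * f t) =O[l] g) (i : ι) (j : κ) : (fun t => f t i j ^ 2) =O[l] g := by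
  rw [isBigO_matrix] at h
  refine IsBigO.trans ?_ (h j j)
  refine IsBigO.of_bound 1 (Eventually.of_forall fun t => ?_)
  simp only [Matrix.mul_apply, transpose_apply, ← pow_two, one_mul]
  rw [Real.norm_of_nonneg (by positivity), Real.norm_of_nonneg (by positivity)]
  exact Finset.single_le_sum (f := fun r => f t r j ^ 2) (fun _ _ => by positivity)
    (Finset.mem_univ i)

theorem isBigO_of_transpose_mul_self {ι κ : Type*} [Fintype ι] [Fintype κ]
    [DecidableEq ι] [DecidableEq κ] {f : T → Matrix ι κ ℝ}
    (h : (fun t => (f t)ᵀ * f t) =O[l] fun _ => (1 : ℝ)) : f =O[l] fun _ => (1 : ℝ) :=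
  isBigO_matrix.2 fun i j => IsBigO.of_pow (n := 2) two_ne_zero
    ((isBigO_sq_entry h i j).congr (fun _ => rfl) fun _ => by simp)

end BigO

/-! ### The QR factorization -/

namespace IsRegularQR

variable {m n p : ℕ} {A : Matrix (Fin m) (Fin n) ℝ} {L : Matrix (Fin p) (Fin n) ℝ}
  {Q : Matrix (Fin m ⊕ Fin p) (Fin n) ℝ} {R : Matrix (Fin n) (Fin n) ℝ}

/-- The stacked matrix has rank `n` and factors through `R`, so `R` has rank at least `n`. -/
theorem isUnit_det (h : IsRegularQR A L Q R) : IsUnit R.det := by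
  rw [← isUnit_iff_isUnit_det, ← linearIndependent_cols_iff_isUnit,
    linearIndependent_iff_card_eq_finrank_span, Set.finrank, ← rank_eq_finrank_span_cols]
  refine le_antisymm ?_ (by simpa using R.rank_le_card_width)
  have := rank_mul_le_right Q R
  rw [← h.factor, h.regular] at this
  simpa using this

theorem A_eq (h : IsRegularQR A L Q R) : A = toRows₁ Q * R := by
  ext i j
  have := congrFun (congrFun h.factor (Sum.inl i)) j
  simpa [Matrix.mul_apply] using this

theorem L_eq (h : IsRegularQR A L Q R) : L = toRows₂ Q * R := by
  ext i j
  have := congrFun (congrFun h.factor (Sum.inr i)) j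
  simpa [Matrix.mul_apply] using this

theorem toRows_mul_add (h : IsRegularQR A L Q R) :
    (toRows₁ Q)ᵀ * toRows₁ Q + (toRows₂ Q)ᵀ * toRows₂ Q = 1 := by
  rw [← h.orthonormal]
  ext i j
  simp [Matrix.mul_apply]

/-- The residual splits orthogonally into `Q z` and the residual `d` of the point `R⁻¹ Qᵀ b`;
minimality and Pythagoras force `Q z = 0`. -/
theorem mulVec_of_isLeastSquaresSol (h : IsRegularQR A L Q R) {b : Fin m ⊕ Fin p → ℝ}
    {x : Fin n → ℝ} (hx : IsLeastSquaresSol A L b x) :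
    fromRows A L *ᵥ x = (Q * Qᵀ) *ᵥ b := by
  have hmin := hx (Set.mem_univ (R⁻¹ *ᵥ (Qᵀ *ᵥ b)))
  simp only [Set.mem_ofPred_eq] at hmin
  have e1 : fromRows A L *ᵥ (R⁻¹ *ᵥ (Qᵀ *ᵥ b)) = (Q * Qᵀ) *ᵥ b := by
    rw [h.factor, mulVec_mulVec, mulVec_mulVec, Matrix.mul_assoc Q, mul_nonsing_inv _ h.isUnit_det,
      Matrix.mul_one]
  rw [e1] at hmin
  set z := R *ᵥ x - Qᵀ *ᵥ b with hz
  set d := (Q * Qᵀ) *ᵥ b - b with hd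
  have e2 : fromRows A L *ᵥ x - b = Q *ᵥ z + d := by
    rw [h.factor, hz, hd, mulVec_sub, mulVec_mulVec, mulVec_mulVec]; abel
  have horth : (Q *ᵥ z) ⬝ᵥ d = 0 := by
    rw [dotProduct_comm, dotProduct_mulVec, ← mulVec_transpose, hd, mulVec_sub, mulVec_mulVec,
      ← Matrix.mul_assoc, h.orthonormal, Matrix.one_mul, sub_self, zero_dotProduct]
  have nsq : ∀ y : Fin m ⊕ Fin p → ℝ, ‖WithLp.toLp 2 y‖ ^ 2 = y ⬝ᵥ y := fun y => by
    rw [norm_toLp_sq]; simp [dotProduct, pow_two]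
  have h2 := pow_le_pow_left₀ (norm_nonneg _) hmin 2
  rw [e2, nsq, nsq, dotProduct_add, add_dotProduct, add_dotProduct, dotProduct_comm d, horth] at h2
  have h3 : (Q *ᵥ z) ⬝ᵥ (Q *ᵥ z) = 0 :=
    le_antisymm (by linarith) (by rw [← nsq]; positivity)
  have h4 : Q *ᵥ z = 0 := dotProduct_self_eq_zero.1 h3
  have : fromRows A L *ᵥ x - b = d := by rw [e2, h4, zero_add]
  rw [hd] at this
  exact sub_left_injective this

/-- The sharp constant 1, rather than an `O(1)`, is needed because the coefficient in the final
bounds is multiplied by exactly `‖R‖`. -/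
theorem norm_transpose_mulVec_le (h : IsRegularQR A L Q R) (v : Fin m ⊕ Fin p → ℝ) :
    ‖WithLp.toLp 2 (Qᵀ *ᵥ v)‖ ≤ ‖WithLp.toLp 2 v‖ := by
  have h1 : ‖Q‖ ≤ 1 := by
    have h2 := l2_opNorm_conjTranspose_mul_self Q
    rw [conjTranspose_eq_transpose_of_trivial, h.orthonormal] at h2
    have h3 : ‖(1 : Matrix (Fin n) (Fin n) ℝ)‖ ≤ 1 := by
      rw [← diagonal_one, l2_opNorm_diagonal]
      exact (pi_norm_le_iff_of_nonneg zero_le_one).2 fun i => by simp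
    nlinarith [norm_nonneg Q]
  refine (norm_toLp_mulVec_le _ _).trans ?_
  rw [l2_opNorm_transpose]
  exact mul_le_of_le_one_left (norm_nonneg _) h1

end IsRegularQR

/-! ### One step of the process -/

section Step

variable {T : Type*} {l : Filter T} {ε : T → ℝ}

theorem isBigO_sub_of_fl {y z : T → ℝ} (h : ∀ t, Fl (ε t) (y t) (z t)) :
    (fun t => y t - z t) =O[l] fun t => ε t * z t := by
  refine IsBigO.of_bound 1 (Eventually.of_forall fun t => ?_)
  rw [one_mul, norm_mul, Real.norm_eq_abs, Real.norm_eq_abs, Real.norm_eq_abs]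
  exact (h t).trans (mul_le_mul_of_nonneg_right (le_abs_self _) (abs_nonneg _))

variable {ι : Type} [Fintype ι] {r a b y : T → ι → ℝ} {ν τ : T → ℝ}

theorem isBigO_one_of_flNormalize (hε : ∀ t, 0 < ε t ∧ ε t ≤ 1 / 2)
    (h : ∀ t, FlNormalize (ε t) (r t) (ν t) (y t)) : y =O[l] fun _ => (1 : ℝ) := by
  obtain ⟨K, hK, H⟩ := FlNormalize.bounds ι
  refine (isBigO_of_toLp y).trans (IsBigO.of_bound (1 + K) (Eventually.of_forall fun t => ?_))
  have := (H (ε t) (hε t).1 (hε t).2 _ _ _ (h t)).2.2.1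
  have := (hε t).2
  simp only [norm_one]
  nlinarith

theorem isBigO_norm_of_flNormalize (hε : ∀ t, 0 < ε t ∧ ε t ≤ 1 / 2)
    (h : ∀ t, FlNormalize (ε t) (r t) (ν t) (y t)) : ν =O[l] r := by
  obtain ⟨K, hK, H⟩ := FlNormalize.bounds ι
  refine IsBigO.trans (IsBigO.of_bound K (Eventually.of_forall fun t => ?_)) (isBigO_toLp r)
  exact (H (ε t) (hε t).1 (hε t).2 _ _ _ (h t)).1

theorem isBigO_smul_sub_of_flNormalize (hε : ∀ t, 0 < ε t ∧ ε t ≤ 1 / 2)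
    (h : ∀ t, FlNormalize (ε t) (r t) (ν t) (y t)) (hr : r =O[l] fun _ => (1 : ℝ)) :
    (fun t => ν t • y t - r t) =O[l] ε := by
  obtain ⟨K, hK, H⟩ := FlNormalize.bounds ι
  rw [isBigO_pi] at *
  intro j
  have h1 : (fun t => (ν t • y t - r t) j) =O[l] fun t => ε t * r t j := by
    refine IsBigO.of_bound 1 (Eventually.of_forall fun t => ?_)
    have := (H (ε t) (hε t).1 (hε t).2 _ _ _ (h t)).2.1 j
    rw [one_mul, norm_mul, Real.norm_of_nonneg (hε t).1.le]
    simpa using this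
  refine h1.trans ?_
  simpa using (isBigO_refl ε l).mul (hr j)

theorem isBigO_of_flSubSmul (hε : ∀ t, 0 < ε t ∧ ε t ≤ 1 / 2)
    (h : ∀ t, FlSubSmul (ε t) (r t) (a t) (τ t) (b t)) (ha : a =O[l] fun _ => (1 : ℝ))
    (hb : (fun t => τ t • b t) =O[l] fun _ => (1 : ℝ)) :
    (fun t => r t - (a t - τ t • b t)) =O[l] ε := by
  choose w hw hr using h
  rw [isBigO_pi] at *
  intro j
  have hε1 : ε =O[l] fun _ => (1 : ℝ) := by
    refine IsBigO.of_bound 1 (Eventually.of_forall fun t => ?_)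
    rw [Real.norm_of_nonneg (hε t).1.le]
    simp only [norm_one]
    linarith [(hε t).2]
  have hbj : (fun t => τ t * b t j) =O[l] fun _ => (1 : ℝ) := hb j
  have h1 : (fun t => w t j - τ t * b t j) =O[l] ε :=
    (isBigO_sub_of_fl fun t => hw t j).trans (by simpa using (isBigO_refl ε l).mul hbj)
  have hw1 : (fun t => a t j - w t j) =O[l] fun _ => (1 : ℝ) :=
    (((ha j).sub hbj).sub (h1.trans hε1)).congr_left fun t => by ring
  have h2 : (fun t => r t j - (a t j - w t j)) =O[l] ε :=
    (isBigO_sub_of_fl fun t => hr t j).trans (by simpa using (isBigO_refl ε l).mul hw1)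
  refine (h2.sub h1).congr_left fun t => ?_
  simp only [Pi.sub_apply, Pi.smul_apply, smul_eq_mul]
  ring

/-- Only the product `τ b` has to be bounded; the bound on the normalizing scalar `ν` is then a
consequence, which allows an induction along the process. -/
theorem isBigO_of_step (hε : ∀ t, 0 < ε t ∧ ε t ≤ 1 / 2)
    (h : ∀ t, FlSubSmul (ε t) (r t) (a t) (τ t) (b t))
    (hn : ∀ t, FlNormalize (ε t) (r t) (ν t) (y t)) (ha : a =O[l] fun _ => (1 : ℝ))
    (hb : (fun t => τ t • b t) =O[l] fun _ => (1 : ℝ)) :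
    ν =O[l] (fun _ => (1 : ℝ)) ∧ (fun t => ν t • y t + τ t • b t - a t) =O[l] ε := by
  have hε1 : ε =O[l] fun _ => (1 : ℝ) := by
    refine IsBigO.of_bound 1 (Eventually.of_forall fun t => ?_)
    rw [Real.norm_of_nonneg (hε t).1.le]
    simp only [norm_one]
    linarith [(hε t).2]
  have h1 := isBigO_of_flSubSmul hε h ha hb
  have hr : r =O[l] fun _ => (1 : ℝ) :=
    ((h1.trans hε1).add (ha.sub hb)).congr_left fun t => by abel
  refine ⟨(isBigO_norm_of_flNormalize hε hn).trans hr, ?_⟩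
  refine ((isBigO_smul_sub_of_flNormalize hε hn hr).add h1).congr_left fun t => ?_
  abel

end Step

/-! ### Runs of the JBD method -/

/-- A run of the `k`-step JBD method in finite precision: the rounding unit, the matrix pair, the
computed quantities. -/
structure Run (m n p k : ℕ) (η ρ : ℝ) where
  ε : ℝ
  A : Matrix (Fin m) (Fin n) ℝ
  L : Matrix (Fin p) (Fin n) ℝ
  Q : Matrix (Fin m ⊕ Fin p) (Fin n) ℝ
  R : Matrix (Fin n) (Fin n) ℝ
  X : Data m p
  c : Fin k → ℝ
  s : Fin k → ℝ
  P : Matrix (Fin (k + 1)) (Fin k) ℝ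
  Pbar : Matrix (Fin k) (Fin k) ℝ
  W : Matrix (Fin k) (Fin k) ℝ
  ε_pos : 0 < ε
  ε_le : ε ≤ 1 / 2
  qr : IsRegularQR A L Q R
  le_norm_R : ρ ≤ ‖R‖
  computed : IsComputed A L k η ε X
  noBreakdown : X.NoBreakdown k
  gsvd : IsComputedGSVD (X.B k) (X.Bbar k) (η * ε) (η * ((1 + ‖(X.Bunder k)⁻¹‖) * ε)) c s P Pbar W

namespace Run

variable {m n p k : ℕ} {η ρ : ℝ}

theorem hε (t : Run m n p k η ρ) : 0 < t.ε ∧ t.ε ≤ 1 / 2 := ⟨t.ε_pos, t.ε_le⟩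

/-- The orthogonal projection of `(u; 0)` onto the range of `Q`. -/
def proj (t : Run m n p k η ρ) (u : Fin m → ℝ) : Fin m ⊕ Fin p → ℝ :=
  (t.Q * t.Qᵀ) *ᵥ Sum.elim u 0

variable {l : Filter (Run m n p k η ρ)}

theorem ε_isBigO_one : (fun t : Run m n p k η ρ => t.ε) =O[l] fun _ => (1 : ℝ) := by
  refine IsBigO.of_bound 1 (Eventually.of_forall fun t => ?_)
  rw [Real.norm_of_nonneg t.ε_pos.le]
  simp only [norm_one]
  linarith [t.ε_le]

theorem Q_isBigO : (fun t : Run m n p k η ρ => t.Q) =O[l] fun _ => (1 : ℝ) := by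
  refine isBigO_of_transpose_mul_self ?_
  simp only [fun t : Run m n p k η ρ => t.qr.orthonormal]
  exact isBigO_const_const _ one_ne_zero _

theorem proj_isBigO {u : Run m n p k η ρ → Fin m → ℝ} (hu : u =O[l] fun _ => (1 : ℝ)) :
    (fun t => t.proj (u t)) =O[l] fun _ => (1 : ℝ) := by
  have h : (fun t => (Sum.elim (u t) 0 : Fin m ⊕ Fin p → ℝ)) =O[l] fun _ => (1 : ℝ) := by
    rw [isBigO_pi] at *
    rintro (j | j)
    · exact hu j
    · exact isBigO_zero (fun _ : Run m n p k η ρ => (1 : ℝ)) l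
  exact ((Q_isBigO.matrix_mul Q_isBigO.matrix_transpose).matrix_mulVec h).congr_right
    fun t => by ring

theorem sub_proj_isBigO {u : Run m n p k η ρ → Fin m → ℝ} {g : Run m n p k η ρ → Fin m ⊕ Fin p → ℝ}
    (h : ∀ t, AccurateProjection t.A t.L (η * t.ε) (u t) (g t)) :
    (fun t => g t - t.proj (u t)) =O[l] fun t => t.ε := by
  refine (isBigO_of_toLp _).trans (IsBigO.of_bound η (Eventually.of_forall fun t => ?_))
  obtain ⟨x, hx, hg⟩ := h t
  rw [proj, ← t.qr.mulVec_of_isLeastSquaresSol hx, Real.norm_of_nonneg t.ε_pos.le]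
  exact hg

theorem u_isBigO {i : ℕ} (h1 : 1 ≤ i) (hi : i ≤ k + 1) :
    (fun t : Run m n p k η ρ => t.X.u i) =O[l] fun _ => (1 : ℝ) := by
  obtain rfl | h2 := eq_or_lt_of_le h1
  · refine (isBigO_of_toLp _).trans (IsBigO.of_bound (1 + |η|) (Eventually.of_forall fun t => ?_))
    have h3 := (abs_le.1 t.computed.start).2
    have h4 : η * t.ε ≤ |η| * 1 :=
      mul_le_mul (le_abs_self _) (by linarith [t.ε_le]) t.ε_pos.le (abs_nonneg _)
    simp only [norm_one]
    linarith
  · obtain ⟨j, rfl⟩ : ∃ j, i = j + 1 := ⟨i - 1, by omega⟩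
    choose r _ hn using fun t : Run m n p k η ρ => t.computed.u_step j (by omega) (by omega)
    exact isBigO_one_of_flNormalize hε hn

theorem v_isBigO {i : ℕ} (h1 : 1 ≤ i) (hi : i ≤ k + 1) :
    (fun t : Run m n p k η ρ => t.X.v i) =O[l] fun _ => (1 : ℝ) := by
  obtain rfl | h2 := eq_or_lt_of_le h1
  · choose g _ hn using fun t : Run m n p k η ρ => t.computed.v_one
    exact isBigO_one_of_flNormalize hε hn
  · obtain ⟨j, rfl⟩ : ∃ j, i = j + 1 := ⟨i - 1, by omega⟩
    choose g r _ _ hn using fun t : Run m n p k η ρ => t.computed.v_step j (by omega) (by omega)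
    exact isBigO_one_of_flNormalize hε hn

theorem uh_isBigO {i : ℕ} (h1 : 1 ≤ i) (hi : i ≤ k + 1) :
    (fun t : Run m n p k η ρ => t.X.uh i) =O[l] fun _ => (1 : ℝ) := by
  obtain rfl | h2 := eq_or_lt_of_le h1
  · exact isBigO_one_of_flNormalize hε fun t : Run m n p k η ρ => t.computed.uh_one
  · obtain ⟨j, rfl⟩ : ∃ j, i = j + 1 := ⟨i - 1, by omega⟩
    choose r _ hn using fun t : Run m n p k η ρ => t.computed.uh_step j (by omega) (by omega)
    exact isBigO_one_of_flNormalize hε hn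

theorem smul_isBigO_one {ι : Type*} [Fintype ι] {τ : Run m n p k η ρ → ℝ}
    {b : Run m n p k η ρ → ι → ℝ} (h : τ =O[l] fun _ => (1 : ℝ)) (hb : b =O[l] fun _ => (1 : ℝ)) :
    (fun t => τ t • b t) =O[l] fun _ => (1 : ℝ) := by
  simpa using h.smul hb

theorem v_one_rec :
    (fun t : Run m n p k η ρ => t.X.α 1) =O[l] (fun _ => (1 : ℝ)) ∧
    (fun t : Run m n p k η ρ => t.X.α 1 • t.X.v 1 - t.proj (t.X.u 1)) =O[l] fun t => t.ε := by
  choose g hg hn using fun t : Run m n p k η ρ => t.computed.v_one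
  have h1 := sub_proj_isBigO (l := l) hg
  have hg1 : g =O[l] fun _ => (1 : ℝ) :=
    ((h1.trans ε_isBigO_one).add (proj_isBigO (u_isBigO le_rfl (by omega)))).congr_left
      fun t => by abel
  refine ⟨(isBigO_norm_of_flNormalize hε hn).trans hg1, ?_⟩
  exact ((isBigO_smul_sub_of_flNormalize hε hn hg1).add h1).congr_left fun t => by abel

theorem inl_isBigO {v : Run m n p k η ρ → Fin m ⊕ Fin p → ℝ} {g : Run m n p k η ρ → ℝ}
    (h : v =O[l] g) : (fun t j => v t (Sum.inl j)) =O[l] g := by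
  rw [isBigO_pi] at *
  exact fun j => h (Sum.inl j)

theorem inr_isBigO {v : Run m n p k η ρ → Fin m ⊕ Fin p → ℝ} {g : Run m n p k η ρ → ℝ}
    (h : v =O[l] g) : (fun t j => v t (Sum.inr j)) =O[l] g := by
  rw [isBigO_pi] at *
  exact fun j => h (Sum.inr j)

theorem u_rec_of {i : ℕ} (h1 : 1 ≤ i) (hi : i ≤ k)
    (hα : (fun t : Run m n p k η ρ => t.X.α i) =O[l] fun _ => (1 : ℝ)) :
    (fun t : Run m n p k η ρ => t.X.β (i + 1)) =O[l] (fun _ => (1 : ℝ)) ∧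
    (fun t : Run m n p k η ρ => t.X.β (i + 1) • t.X.u (i + 1) + t.X.α i • t.X.u i -
      fun j => t.X.v i (Sum.inl j)) =O[l] fun t => t.ε := by
  choose r hr hn using fun t : Run m n p k η ρ => t.computed.u_step i h1 hi
  exact isBigO_of_step hε hr hn (inl_isBigO (v_isBigO h1 (by omega)))
    (smul_isBigO_one hα (u_isBigO h1 (by omega)))

theorem v_rec_of {i : ℕ} (h1 : 1 ≤ i) (hi : i ≤ k)
    (hβ : (fun t : Run m n p k η ρ => t.X.β (i + 1)) =O[l] fun _ => (1 : ℝ)) :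
    (fun t : Run m n p k η ρ => t.X.α (i + 1)) =O[l] (fun _ => (1 : ℝ)) ∧
    (fun t : Run m n p k η ρ => t.X.α (i + 1) • t.X.v (i + 1) + t.X.β (i + 1) • t.X.v i -
      t.proj (t.X.u (i + 1))) =O[l] fun t => t.ε := by
  choose g r hg hr hn using fun t : Run m n p k η ρ => t.computed.v_step i h1 hi
  have h2 := sub_proj_isBigO (l := l) hg
  have hg1 : g =O[l] fun _ => (1 : ℝ) :=
    ((h2.trans ε_isBigO_one).add
      (proj_isBigO (u_isBigO (i := i + 1) (by omega) (by omega)))).congr_left fun t => by abel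
  obtain ⟨h3, h4⟩ := isBigO_of_step hε hr hn hg1 (smul_isBigO_one hβ (v_isBigO h1 (by omega)))
  exact ⟨h3, (h4.add h2).congr_left fun t => by abel⟩

/-- The bounds alternate: a bounded `α_i` gives a bounded `β_{i+1}` through the `u`-step, and this
gives a bounded `α_{i+1}` through the `v`-step. No such argument exists for `β̂_i`, which is a
quotient by `α̂_i`. -/
theorem α_isBigO {i : ℕ} (h1 : 1 ≤ i) (hi : i ≤ k + 1) :
    (fun t : Run m n p k η ρ => t.X.α i) =O[l] fun _ => (1 : ℝ) := by
  induction i, h1 using Nat.le_induction with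
  | base => exact v_one_rec.1
  | succ i h1 ih =>
    exact (v_rec_of h1 (by omega) (u_rec_of h1 (by omega) (ih (by omega))).1).1

theorem β_isBigO {i : ℕ} (h1 : 1 ≤ i) (hi : i ≤ k) :
    (fun t : Run m n p k η ρ => t.X.β (i + 1)) =O[l] fun _ => (1 : ℝ) :=
  (u_rec_of h1 hi (α_isBigO h1 (by omega))).1

theorem u_rec {i : ℕ} (h1 : 1 ≤ i) (hi : i ≤ k) :
    (fun t : Run m n p k η ρ => t.X.β (i + 1) • t.X.u (i + 1) + t.X.α i • t.X.u i -
      fun j => t.X.v i (Sum.inl j)) =O[l] fun t => t.ε :=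
  (u_rec_of h1 hi (α_isBigO h1 (by omega))).2

theorem v_rec {i : ℕ} (h1 : 1 ≤ i) (hi : i ≤ k) :
    (fun t : Run m n p k η ρ => t.X.α (i + 1) • t.X.v (i + 1) + t.X.β (i + 1) • t.X.v i -
      t.proj (t.X.u (i + 1))) =O[l] fun t => t.ε :=
  (v_rec_of h1 hi (β_isBigO h1 hi)).2

theorem uh_one_rec :
    (fun t : Run m n p k η ρ => t.X.αh 1) =O[l] (fun _ => (1 : ℝ)) ∧
    (fun t : Run m n p k η ρ => t.X.αh 1 • t.X.uh 1 - fun j => t.X.v 1 (Sum.inr j)) =O[l]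
      fun t => t.ε := by
  have hv : (fun (t : Run m n p k η ρ) j => t.X.v 1 (Sum.inr j)) =O[l] fun _ => (1 : ℝ) :=
    inr_isBigO (v_isBigO le_rfl (by omega))
  have hn := fun t : Run m n p k η ρ => t.computed.uh_one
  exact ⟨(isBigO_norm_of_flNormalize hε hn).trans hv, isBigO_smul_sub_of_flNormalize hε hn hv⟩

theorem uh_rec {i : ℕ} (h1 : 1 ≤ i) (hi : i ≤ k)
    (hβ : (fun t : Run m n p k η ρ => t.X.βh i) =O[l] fun _ => (1 : ℝ)) :
    (fun t : Run m n p k η ρ => t.X.αh (i + 1) • t.X.uh (i + 1) + t.X.βh i • t.X.uh i -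
      fun j => (-1) ^ i * t.X.v (i + 1) (Sum.inr j)) =O[l] fun t => t.ε := by
  choose r hr hn using fun t : Run m n p k η ρ => t.computed.uh_step i h1 hi
  refine (isBigO_of_step hε hr hn ?_ (smul_isBigO_one hβ (uh_isBigO h1 (by omega)))).2
  have := inr_isBigO (l := l) (v_isBigO (m := m) (n := n) (p := p) (η := η) (ρ := ρ)
    (i := i + 1) (by omega) (show i + 1 ≤ k + 1 by omega))
  exact this.const_smul_left ((-1 : ℝ) ^ i)

/-- Keeping the factor `α_{i+1}` in the first estimate matters for `i = k`: it compensates the lack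
of control of `v'_{k+1}` when `α_{k+1}` is small or zero. -/
theorem βh_rec {i : ℕ} (h1 : 1 ≤ i) (hi : i ≤ k) :
    (fun t : Run m n p k η ρ => t.X.αh i * t.X.βh i) =O[l] (fun t => t.X.α (i + 1)) ∧
    (fun t : Run m n p k η ρ => t.X.αh i * t.X.βh i - t.X.α (i + 1) * t.X.β (i + 1)) =O[l]
      fun t => t.ε := by
  choose q hq hb using fun t : Run m n p k η ρ => t.computed.βh_step i h1 hi
  have hα := α_isBigO (m := m) (n := n) (p := p) (η := η) (ρ := ρ) (l := l)
    (i := i + 1) (by omega) (show i + 1 ≤ k + 1 by omega)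
  have hβ := β_isBigO (m := m) (n := n) (p := p) (η := η) (ρ := ρ) (l := l) h1 hi
  have h2 := isBigO_sub_of_fl (l := l) hq
  have e0 : (fun t : Run m n p k η ρ => t.ε * (t.X.α (i + 1) * t.X.β (i + 1))) =O[l]
      fun t => t.ε * t.X.α (i + 1) := by
    simpa using (isBigO_refl (fun t : Run m n p k η ρ => t.ε) l).mul ((isBigO_refl _ l).mul hβ)
  have e1 : (fun t : Run m n p k η ρ => t.X.α (i + 1) * t.X.β (i + 1)) =O[l]
      fun t => t.X.α (i + 1) := by
    simpa using (isBigO_refl _ l).mul hβ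
  have e2 : (fun t : Run m n p k η ρ => t.ε * t.X.α (i + 1)) =O[l] fun t => t.X.α (i + 1) := by
    simpa using ε_isBigO_one.mul (isBigO_refl (fun t : Run m n p k η ρ => t.X.α (i + 1)) l)
  have hq1 : q =O[l] fun t => t.X.α (i + 1) :=
    (((h2.trans e0).trans e2).add e1).congr_left fun t => by ring
  have h3 : (fun t : Run m n p k η ρ => t.X.αh i * t.X.βh i - q t) =O[l] fun t => t.ε * q t := by
    have := (isBigO_refl (fun t : Run m n p k η ρ => t.X.αh i) l).mul (isBigO_sub_of_fl (l := l) hb)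
    refine this.congr (fun t => ?_) fun t => ?_
    · have := (t.noBreakdown.1 i h1 hi).2
      field_simp
    · have := (t.noBreakdown.1 i h1 hi).2
      field_simp
  have h4 : (fun t : Run m n p k η ρ => t.ε * q t) =O[l] fun t => t.ε * t.X.α (i + 1) :=
    (isBigO_refl _ l).mul hq1
  have h5 : (fun t : Run m n p k η ρ => t.X.αh i * t.X.βh i - t.X.α (i + 1) * t.X.β (i + 1)) =O[l]
      fun t => t.ε * t.X.α (i + 1) :=
    ((h3.trans h4).add (h2.trans e0)).congr_left fun t => by ring
  refine ⟨((h5.trans e2).add e1).congr_left fun t => by ring, h5.trans ?_⟩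
  simpa using (isBigO_refl (fun t : Run m n p k η ρ => t.ε) l).mul hα

end Run

/-! ### The bidiagonal matrices -/

/-- The last index of `Fin k`, for `1 ≤ k`. -/
def lastIdx {k : ℕ} (hk : 1 ≤ k) : Fin k := Fin.cast (Nat.sub_add_cancel hk) (Fin.last (k - 1))

@[simp]
theorem val_lastIdx {k : ℕ} (hk : 1 ≤ k) : (lastIdx hk : ℕ) = k - 1 := rfl

theorem sum_ite_eq_val (k i : ℕ) (g : ℕ → ℝ) :
    ∑ j : Fin k, (if i = j then g j else 0) = if i < k then g i else 0 := by
  rw [Fin.sum_univ_eq_sum_range (fun j => if i = j then g j else 0)]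
  simp

theorem sum_ite_eq_val_add_one (k i : ℕ) (g : ℕ → ℝ) :
    ∑ j : Fin k, (if i = j + 1 then g j else 0) = if 1 ≤ i ∧ i < k + 1 then g (i - 1) else 0 := by
  cases i with
  | zero => simp
  | succ i => simpa using sum_ite_eq_val k i g

namespace Data

variable {m p : ℕ} (X : Data m p) (k : ℕ)

theorem B_apply (i : Fin (k + 1)) (j : Fin k) : X.B k i j =
    (if (i : ℕ) = j then X.α (j + 1) else 0) + if (i : ℕ) = j + 1 then X.β (j + 2) else 0 := by
  unfold B
  split_ifs <;> first | omega | simp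

theorem Bhat_apply (i j : Fin k) : X.Bhat k i j =
    (if (j : ℕ) = i then X.αh (i + 1) else 0) + if (j : ℕ) = i + 1 then X.βh (i + 1) else 0 := by
  unfold Bhat
  split_ifs <;> first | omega | simp

theorem sum_mul_B_row (f : ℕ → ℝ) (i : Fin (k + 1)) : ∑ j : Fin k, f (j + 1) * X.B k i j =
    (if (i : ℕ) < k then X.α (i + 1) * f (i + 1) else 0) +
      if 1 ≤ (i : ℕ) then X.β (i + 1) * f i else 0 := by
  have h1 := sum_ite_eq_val k i fun j => X.α (j + 1) * f (j + 1)
  have h2 := sum_ite_eq_val_add_one k i fun j => X.β (j + 2) * f (j + 1)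
  have e : (1 ≤ (i : ℕ) ∧ (i : ℕ) < k + 1) ↔ 1 ≤ (i : ℕ) := by omega
  rw [if_congr e rfl rfl] at h2
  rw [← h1, Finset.sum_congr rfl fun j _ => by rw [B_apply]]
  have h3 : (if 1 ≤ (i : ℕ) then X.β (i + 1) * f i else 0) =
      if 1 ≤ (i : ℕ) then X.β (i - 1 + 2) * f (i - 1 + 1) else 0 := by
    split_ifs with h
    · rw [show (i : ℕ) - 1 + 2 = i + 1 by omega, show (i : ℕ) - 1 + 1 = i by omega]
    · rfl
  rw [h3, ← h2, ← Finset.sum_add_distrib]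
  refine Finset.sum_congr rfl fun j _ => ?_
  rw [mul_add, mul_ite, mul_ite]
  simp [mul_comm]

theorem sum_mul_B_col (f : ℕ → ℝ) (j : Fin k) : ∑ i : Fin (k + 1), f (i + 1) * X.B k i j =
    X.α (j + 1) * f (j + 1) + X.β (j + 2) * f (j + 2) := by
  have h1 := sum_ite_eq_val (k + 1) j fun i => X.α (j + 1) * f (i + 1)
  have h2 := sum_ite_eq_val (k + 1) (j + 1) fun i => X.β (j + 2) * f (i + 1)
  rw [if_pos (by omega)] at h1 h2
  rw [← h1, ← h2, ← Finset.sum_add_distrib]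
  refine Finset.sum_congr rfl fun i _ => ?_
  rw [B_apply, mul_add, mul_ite, mul_ite]
  simp [mul_comm, eq_comm]

theorem sum_mul_Bhat_col (f : ℕ → ℝ) (j : Fin k) : ∑ i : Fin k, f (i + 1) * X.Bhat k i j =
    X.αh (j + 1) * f (j + 1) + if 1 ≤ (j : ℕ) then X.βh j * f j else 0 := by
  have h1 := sum_ite_eq_val k j fun i => X.αh (i + 1) * f (i + 1)
  have h2 := sum_ite_eq_val_add_one k j fun i => X.βh (i + 1) * f (i + 1)
  have e : (1 ≤ (j : ℕ) ∧ (j : ℕ) < k + 1) ↔ 1 ≤ (j : ℕ) := by omega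
  rw [if_congr e rfl rfl] at h2
  rw [if_pos (by omega)] at h1
  have h3 : (if 1 ≤ (j : ℕ) then X.βh j * f j else 0) =
      if 1 ≤ (j : ℕ) then X.βh (j - 1 + 1) * f (j - 1 + 1) else 0 := by
    split_ifs with h
    · rw [show (j : ℕ) - 1 + 1 = j by omega]
    · rfl
  rw [h3, ← h1, ← h2, ← Finset.sum_add_distrib]
  refine Finset.sum_congr rfl fun i _ => ?_
  rw [Bhat_apply, mul_add, mul_ite, mul_ite]
  simp [mul_comm]

variable {X k}

theorem NoBreakdown.isUnit_det_Bunder (h : X.NoBreakdown k) : IsUnit (X.Bunder k).det := by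
  rw [det_of_isLowerTriangular, isUnit_iff_ne_zero, Finset.prod_ne_zero_iff]
  · intro i _
    simpa [Bunder, B] using (h.1 (i + 1) (by omega) (by omega)).1
  · intro i j hij
    have hij : i < j := hij
    have hij' : (i : ℕ) < j := hij
    change (if (i : ℕ) = j then _ else if (i : ℕ) = j + 1 then _ else 0) = 0
    rw [if_neg (by omega), if_neg (by omega)]

theorem NoBreakdown.isUnit_det_Bhat (h : X.NoBreakdown k) : IsUnit (X.Bhat k).det := by
  rw [det_of_isUpperTriangular, isUnit_iff_ne_zero, Finset.prod_ne_zero_iff]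
  · intro i _
    simpa [Bhat] using (h.1 (i + 1) (by omega) (by omega)).2
  · intro i j hij
    have hij : j < i := hij
    have hij' : (j : ℕ) < i := hij
    change (if (i : ℕ) = j then _ else if (j : ℕ) = i + 1 then _ else 0) = 0
    rw [if_neg (by omega), if_neg (by omega)]

end Data

namespace Run

variable {m n p k : ℕ} {η ρ : ℝ} {l : Filter (Run m n p k η ρ)}

/-- The norm of the inverse of the leading principal submatrix of `B_k`. -/
def κ (t : Run m n p k η ρ) : ℝ := ‖(t.X.Bunder k)⁻¹‖

/-- The norm of the inverse of `B̂_k`. -/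
def κh (t : Run m n p k η ρ) : ℝ := ‖(t.X.Bhat k)⁻¹‖

theorem κ_nonneg (t : Run m n p k η ρ) : 0 ≤ t.κ := norm_nonneg _
theorem κh_nonneg (t : Run m n p k η ρ) : 0 ≤ t.κh := norm_nonneg _

theorem B_isBigO : (fun t : Run m n p k η ρ => t.X.B k) =O[l] fun _ => (1 : ℝ) := by
  rw [isBigO_matrix]
  intro i j
  simp only [Data.B_apply]
  refine IsBigO.add ?_ ?_
  · split_ifs
    · exact α_isBigO (by omega) (by omega)
    · exact isBigO_zero _ _
  · split_ifs
    · exact β_isBigO (by omega) (by omega)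
    · exact isBigO_zero _ _

theorem Bunder_isBigO : (fun t : Run m n p k η ρ => t.X.Bunder k) =O[l] fun _ => (1 : ℝ) := by
  have := B_isBigO (l := l) (m := m) (n := n) (p := p) (k := k) (η := η) (ρ := ρ)
  rw [isBigO_matrix] at *
  exact fun i j => this i.castSucc j

theorem Bunder_inv_isBigO :
    (fun t : Run m n p k η ρ => (t.X.Bunder k)⁻¹) =O[l] fun t => t.κ :=
  IsBigO.of_bound 1 (Eventually.of_forall fun t => by
    rw [Real.norm_of_nonneg t.κ_nonneg, one_mul, κ])

theorem Bhat_inv_isBigO :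
    (fun t : Run m n p k η ρ => (t.X.Bhat k)⁻¹) =O[l] fun t => t.κh :=
  IsBigO.of_bound 1 (Eventually.of_forall fun t => by
    rw [Real.norm_of_nonneg t.κh_nonneg, one_mul, κh])

/-- A bounded matrix cannot have a small inverse. -/
theorem one_isBigO_κ (hk : 1 ≤ k) :
    (fun _ : Run m n p k η ρ => (1 : ℝ)) =O[l] fun t => t.κ := by
  have h := (Bunder_inv_isBigO (l := l) (m := m) (n := n) (p := p) (k := k) (η := η)
    (ρ := ρ)).matrix_mul Bunder_isBigO
  rw [isBigO_matrix] at h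
  refine (h ⟨0, hk⟩ ⟨0, hk⟩).congr (fun t => ?_) fun t => mul_one _
  rw [nonsing_inv_mul _ t.noBreakdown.isUnit_det_Bunder, one_apply_eq]

/-- `B̂_k` is not known to be bounded here, but its first column has the single nonzero entry
`α̂_1`, which is bounded, and `α̂_1` times the first diagonal entry of the inverse is 1. -/
theorem one_isBigO_κh (hk : 1 ≤ k) :
    (fun _ : Run m n p k η ρ => (1 : ℝ)) =O[l] fun t => t.κh := by
  have h := Bhat_inv_isBigO (l := l) (m := m) (n := n) (p := p) (k := k) (η := η) (ρ := ρ)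
  rw [isBigO_matrix] at h
  refine ((h ⟨0, hk⟩ ⟨0, hk⟩).mul uh_one_rec.1).congr (fun t => ?_) fun t => mul_one _
  have h1 := congrFun (congrFun (nonsing_inv_mul _ t.noBreakdown.isUnit_det_Bhat) ⟨0, hk⟩) ⟨0, hk⟩
  rw [Matrix.mul_apply, one_apply_eq, Finset.sum_eq_single ⟨0, hk⟩] at h1
  · simpa [Data.Bhat] using h1
  · intro j _ hj
    have : (j : ℕ) ≠ 0 := fun h => hj (Fin.ext h)
    simp [Data.Bhat, this]
  · simp

theorem Bhat_inv_last_row (hk : 1 ≤ k) (t : Run m n p k η ρ) (j : Fin k) :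
    t.X.αh k * (t.X.Bhat k)⁻¹ (lastIdx hk) j = if j = (lastIdx hk) then 1 else 0 := by
  have h1 := congrFun (congrFun (mul_nonsing_inv _ t.noBreakdown.isUnit_det_Bhat)
    (lastIdx hk)) j
  rw [Matrix.mul_apply, one_apply, Finset.sum_eq_single (lastIdx hk)] at h1
  · simpa [Data.Bhat, Nat.sub_add_cancel hk, eq_comm] using h1
  · intro i _ hi
    have : (i : ℕ) ≠ k - 1 := fun h => hi (Fin.ext h)
    have h2 : ¬ (k - 1 = (i : ℕ)) := fun h => this h.symm
    have h3 : ¬ ((i : ℕ) = k - 1 + 1) := by omega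
    simp [Data.Bhat, h2, h3]
  · simp

theorem αh_inv_isBigO (hk : 1 ≤ k) :
    (fun t : Run m n p k η ρ => (t.X.αh k)⁻¹) =O[l] fun t => t.κh := by
  have h := Bhat_inv_isBigO (l := l) (m := m) (n := n) (p := p) (k := k) (η := η) (ρ := ρ)
  rw [isBigO_matrix] at h
  refine (h (lastIdx hk) (lastIdx hk)).congr_left fun t => ?_
  have h1 := t.Bhat_inv_last_row hk (lastIdx hk)
  rw [if_pos rfl] at h1
  exact eq_inv_of_mul_eq_one_right h1

theorem βh_last_isBigO (hk : 1 ≤ k) :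
    (fun t : Run m n p k η ρ => t.X.βh k) =O[l] fun t => t.κh * t.X.α (k + 1) := by
  refine ((αh_inv_isBigO hk).mul (βh_rec hk le_rfl).1).congr_left fun t => ?_
  have := (t.noBreakdown.1 k hk le_rfl).2
  field_simp

/-! ### The recurrences in matrix form -/

theorem V_isBigO : (fun t : Run m n p k η ρ => t.X.V k) =O[l] fun _ => (1 : ℝ) := by
  rw [isBigO_matrix]
  exact fun i j => isBigO_pi.1 (v_isBigO (by omega) (by omega)) i

theorem U_isBigO : (fun t : Run m n p k η ρ => t.X.U k) =O[l] fun _ => (1 : ℝ) := by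
  rw [isBigO_matrix]
  exact fun i j => isBigO_pi.1 (u_isBigO (by omega) (by omega)) i

theorem Uhat_isBigO : (fun t : Run m n p k η ρ => t.X.Uhat k) =O[l] fun _ => (1 : ℝ) := by
  rw [isBigO_matrix]
  exact fun i j => isBigO_pi.1 (uh_isBigO (by omega) (by omega)) i

/-- `U_{k+1}`, with rows of zeros appended. -/
def U₀ (t : Run m n p k η ρ) : Matrix (Fin m ⊕ Fin p) (Fin (k + 1)) ℝ := fromRows (t.X.U k) 0

theorem proj_apply (t : Run m n p k η ρ) (a : Fin m ⊕ Fin p) (j : Fin (k + 1)) :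
    (t.Q * t.Qᵀ * t.U₀) a j = t.proj (t.X.u (j + 1)) a := by
  rw [Matrix.mul_apply, proj, mulVec, dotProduct]
  refine Finset.sum_congr rfl fun b _ => ?_
  rcases b with b | b <;> simp [U₀, Data.U]

theorem V_mul_B_transpose :
    (fun t : Run m n p k η ρ => t.X.V k * (t.X.B k)ᵀ +
      vecMulVec (t.X.v (k + 1)) (Pi.single (Fin.last k) (t.X.α (k + 1))) -
      t.Q * t.Qᵀ * t.U₀) =O[l] fun t => t.ε := by
  rw [isBigO_matrix]
  intro a j
  have key : ∀ t : Run m n p k η ρ, (t.X.V k * (t.X.B k)ᵀ +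
      vecMulVec (t.X.v (k + 1)) (Pi.single (Fin.last k) (t.X.α (k + 1))) -
      t.Q * t.Qᵀ * t.U₀) a j =
      t.X.α (j + 1) * t.X.v (j + 1) a +
        (if 1 ≤ (j : ℕ) then t.X.β (j + 1) * t.X.v j a else 0) - t.proj (t.X.u (j + 1)) a := by
    intro t
    rw [Matrix.sub_apply, Matrix.add_apply, proj_apply, Matrix.mul_apply]
    have h := t.X.sum_mul_B_row k (fun i => t.X.v i a) j
    simp only [transpose_apply, Data.V]
    rw [h, vecMulVec_apply]
    obtain hj | hj := lt_or_eq_of_le (Nat.lt_succ_iff.1 j.2)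
    · rw [if_pos hj, Pi.single_eq_of_ne (by rw [Ne, Fin.ext_iff]; simpa using hj.ne)]
      ring
    · have : j = Fin.last k := Fin.ext hj
      subst this
      simp
      ring
  simp only [key]
  by_cases hj : 1 ≤ (j : ℕ)
  · simp only [if_pos hj]
    exact isBigO_pi.1 (v_rec hj (by omega)) a
  · have : (j : ℕ) = 0 := by omega
    simp only [this, if_neg (show ¬ 1 ≤ 0 by omega), add_zero, zero_add]
    exact isBigO_pi.1 v_one_rec.2 a

theorem toRows₁_V_sub : (fun t : Run m n p k η ρ => toRows₁ (t.X.V k) - t.X.U k * t.X.B k) =O[l]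
    fun t => t.ε := by
  rw [isBigO_matrix]
  intro a j
  refine (isBigO_pi.1 (u_rec (i := j + 1) (by omega) (by omega)) a).neg_left.congr_left fun t => ?_
  have h := t.X.sum_mul_B_col k (fun i => t.X.u i a) j
  rw [Matrix.sub_apply, Matrix.mul_apply]
  simp only [Data.U, toRows₁_apply, Data.V]
  rw [h]
  simp
  ring

/-- Rounding in `β̂_i û_i` is controlled only once `β̂_i` is bounded; the hypothesis is supplied in
the regime of small errors by `βh_isBigO`. -/
theorem toRows₂_V_sub (hβ : ∀ i, 1 ≤ i → i < k →
      (fun t : Run m n p k η ρ => t.X.βh i) =O[l] fun _ => (1 : ℝ)) :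
    (fun t : Run m n p k η ρ => toRows₂ (t.X.V k) - t.X.Uhat k * t.X.Bbar k) =O[l]
      fun t => t.ε := by
  rw [isBigO_matrix]
  intro a j
  -- The signs of `D_k` undo the factor `(-1)^j` that the process attaches to `v'_{j+1}`.
  have key : ∀ t : Run m n p k η ρ, (toRows₂ (t.X.V k) - t.X.Uhat k * t.X.Bbar k) a j =
      (-(-1) ^ (j : ℕ)) * (t.X.αh (j + 1) * t.X.uh (j + 1) a +
        (if 1 ≤ (j : ℕ) then t.X.βh j * t.X.uh j a else 0) -
          (-1) ^ (j : ℕ) * t.X.v (j + 1) (Sum.inr a)) := by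
    intro t
    have h := t.X.sum_mul_Bhat_col k (fun i => t.X.uh i a) j
    rw [Matrix.sub_apply, Data.Bbar, ← Matrix.mul_assoc, mul_diagonal, Matrix.mul_apply]
    simp only [Data.Uhat, toRows₂_apply, Data.V]
    rw [h]
    have e : ((-1 : ℝ) ^ (j : ℕ)) * (-1) ^ (j : ℕ) = 1 := by
      rw [← mul_pow]; simp
    linear_combination (-t.X.v (j + 1) (Sum.inr a)) * e
  simp only [key]
  refine IsBigO.const_mul_left ?_ _
  by_cases hj : 1 ≤ (j : ℕ)
  · simp only [if_pos hj]
    exact isBigO_pi.1 (uh_rec hj (by omega) (hβ j hj j.2)) a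
  · have : (j : ℕ) = 0 := by omega
    simp only [this, if_neg (show ¬ 1 ≤ 0 by omega), add_zero, zero_add, pow_zero, one_mul]
    exact isBigO_pi.1 uh_one_rec.2 a

theorem one_sub_proj_isBigO : (fun t : Run m n p k η ρ => 1 - t.Q * t.Qᵀ) =O[l]
    fun _ => (1 : ℝ) :=
  (isBigO_const_const _ one_ne_zero _).sub
    ((Q_isBigO.matrix_mul Q_isBigO.matrix_transpose).congr_right fun _ => mul_one _)

theorem one_sub_proj_mul (t : Run m n p k η ρ) {ι : Type*} (M : Matrix (Fin m ⊕ Fin p) ι ℝ) :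
    (1 - t.Q * t.Qᵀ) * (t.Q * t.Qᵀ * M) = 0 := by
  have : t.Q * t.Qᵀ * (t.Q * t.Qᵀ * M) = t.Q * (t.Qᵀ * t.Q) * t.Qᵀ * M := by
    simp only [Matrix.mul_assoc]
  rw [Matrix.sub_mul, Matrix.one_mul, this, t.qr.orthonormal, Matrix.mul_one, sub_self]

/-- The computed `v'_i` drift from the range of `Q`. The first `k` columns of the `V'`-recurrence
say that `V' B̲ᵀ` lies in this range up to `O(ε)`; cancelling `B̲ᵀ` costs the factor `κ`. -/
theorem one_sub_proj_mul_V :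
    (fun t : Run m n p k η ρ => (1 - t.Q * t.Qᵀ) * t.X.V k) =O[l] fun t => t.κ * t.ε := by
  have h0 := V_mul_B_transpose (l := l) (m := m) (n := n) (p := p) (η := η) (ρ := ρ)
  have h1 : (fun t : Run m n p k η ρ => t.X.V k * (t.X.Bunder k)ᵀ -
      t.Q * t.Qᵀ * t.U₀.submatrix id Fin.castSucc) =O[l] fun t => t.ε := by
    rw [isBigO_matrix] at *
    intro a j
    refine (h0 a j.castSucc).congr_left fun t => ?_
    rw [Matrix.sub_apply, Matrix.add_apply, vecMulVec_apply,
      Pi.single_eq_of_ne (Fin.castSucc_lt_last j).ne]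
    simp [Matrix.mul_apply, Data.Bunder]
  have h2 := (one_sub_proj_isBigO.matrix_mul h1).matrix_mul
    (Bunder_inv_isBigO (l := l)).matrix_transpose
  refine h2.congr (fun t => ?_) fun _ => by ring
  rw [Matrix.mul_sub, one_sub_proj_mul, sub_zero, Matrix.mul_assoc, Matrix.mul_assoc,
    ← transpose_mul, nonsing_inv_mul _ t.noBreakdown.isUnit_det_Bunder, transpose_one,
    Matrix.mul_one]

/-- The last column of the `V'`-recurrence, in which the drift of `V'` is already known. The scalar
`α_{k+1}` is kept, since it may be arbitrarily small. -/
theorem one_sub_proj_mulVec_v (hk : 1 ≤ k) :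
    (fun t : Run m n p k η ρ => t.X.α (k + 1) • ((1 - t.Q * t.Qᵀ) *ᵥ t.X.v (k + 1))) =O[l]
      fun t => t.κ * t.ε := by
  have hεκ : (fun t : Run m n p k η ρ => t.ε) =O[l] fun t => t.κ * t.ε :=
    ((one_isBigO_κ hk).mul (isBigO_refl _ l)).congr_left fun t => one_mul _
  have h1 := (one_sub_proj_isBigO.matrix_mul (V_mul_B_transpose (l := l) (m := m) (n := n) (p := p)
    (η := η) (ρ := ρ))).congr_right fun t => one_mul _
  have h2 := ((one_sub_proj_mul_V (l := l) (m := m) (n := n) (p := p)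
    (η := η) (ρ := ρ)).matrix_mul B_isBigO.matrix_transpose).congr_right fun t => mul_one _
  have h3 := (h1.trans hεκ).sub h2
  rw [isBigO_matrix] at h3
  rw [isBigO_pi]
  intro a
  refine (h3 a (Fin.last k)).congr_left fun t => ?_
  rw [Matrix.mul_sub, one_sub_proj_mul, sub_zero, Matrix.mul_add, ← Matrix.mul_assoc,
    add_sub_cancel_left, mul_vecMulVec, vecMulVec_apply]
  simp [mul_comm]

end Run

/-! ### Asymptotic estimates for approximate decompositions and inverses -/

section BigO

variable {T : Type*} {l : Filter T}

/-- This keeps products such as `P̄ Ψ` of size `1 + κ ε` instead of its square when each factor is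
only known to be of the order of the square root of `1 + κ ε`. -/
theorem isBigO_mul_of_sq {f f' g : T → ℝ} (h : (fun t => f t ^ 2) =O[l] g)
    (h' : (fun t => f' t ^ 2) =O[l] g) : (fun t => f t * f' t) =O[l] g := by
  refine IsBigO.of_pow (n := 2) two_ne_zero ?_
  exact (h.mul h').congr (fun t => by simp; ring) fun t => by simp; ring

theorem isBigO_diagonal {κ : Type*} [Fintype κ] [DecidableEq κ] {d : T → κ → ℝ} {g : T → ℝ}
    (h : ∀ j, (fun t => d t j) =O[l] g) : (fun t => diagonal (d t)) =O[l] g := by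
  rw [isBigO_matrix]
  intro i j
  by_cases hij : i = j
  · subst hij; simpa using h i
  · simpa [hij] using isBigO_zero g l

theorem isBigO_col {ι κ : Type*} [Fintype ι] [Fintype κ] [DecidableEq ι] [DecidableEq κ]
    {f : T → Matrix ι κ ℝ} {g : T → ℝ} (h : f =O[l] g) (j : κ) :
    (fun t => (f t).col j) =O[l] g := by
  rw [isBigO_matrix] at h
  exact isBigO_pi.2 fun i => h i j

theorem isBigO_vecMulVec {ι κ : Type*} [Fintype ι] [Fintype κ] [DecidableEq ι] [DecidableEq κ]
    {f : T → ι → ℝ} {f' : T → κ → ℝ} {g g' : T → ℝ} (h : f =O[l] g) (h' : f' =O[l] g') :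
    (fun t => vecMulVec (f t) (f' t)) =O[l] fun t => g t * g' t := by
  rw [isBigO_matrix]
  exact fun i j => (isBigO_pi.1 h i).mul (isBigO_pi.1 h' j)

/-- Consequences of an approximate singular value decomposition. -/
theorem isBigO_of_approx_svd {ι κ τ : Type*} [Fintype ι] [Fintype κ] [DecidableEq ι]
    [DecidableEq κ] [Fintype τ] [DecidableEq τ]
    {B : T → Matrix ι τ ℝ} {P : T → Matrix ι κ ℝ} {W : T → Matrix τ κ ℝ}
    {d : T → κ → ℝ} {g : T → ℝ} (h : (fun t => B t - P t * diagonal (d t) * (W t)ᵀ) =O[l] g)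
    (hP : (fun t => (P t)ᵀ * P t - 1) =O[l] g) (hW : (fun t => (W t)ᵀ * W t - 1) =O[l] g)
    (hP1 : P =O[l] fun _ => (1 : ℝ)) (hW1 : W =O[l] fun _ => (1 : ℝ))
    (hd : ∀ j, (fun t => d t j) =O[l] fun _ => (1 : ℝ)) :
    (fun t => B t * W t - P t * diagonal (d t)) =O[l] g ∧
    (fun t => (B t)ᵀ * P t - W t * diagonal (d t)) =O[l] g := by
  have hd1 := isBigO_diagonal hd
  constructor
  · have h1 := ((h.matrix_mul hW1).congr_right fun t => mul_one _).add
      (((hP1.matrix_mul hd1).matrix_mul hW).congr_right fun t => by ring)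
    refine h1.congr_left fun t => ?_
    rw [Matrix.sub_mul, Matrix.mul_sub, Matrix.mul_one, Matrix.mul_assoc _ _ (W t)]
    abel
  · have h1 := ((h.matrix_transpose.matrix_mul hP1).congr_right fun t => mul_one _).add
      (((hW1.matrix_mul hd1).matrix_mul hP).congr_right fun t => by ring)
    refine h1.congr_left fun t => ?_
    rw [transpose_sub, transpose_mul, transpose_mul, transpose_transpose, diagonal_transpose,
      Matrix.sub_mul, Matrix.mul_sub, Matrix.mul_one]
    simp only [Matrix.mul_assoc]
    abel

theorem isBigO_inv_of_tendsto {h s : T → ℝ} (hs : ∀ t, s t ≠ 0)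
    (hhs : Tendsto (fun t => h t * s t) l (𝓝 1)) : (fun t => (s t)⁻¹) =O[l] h := by
  refine IsBigO.of_bound 2 ?_
  have := hhs.eventually (lt_mem_nhds (show (1 / 2 : ℝ) < 1 by norm_num))
  filter_upwards [this] with t ht
  have h0 := hs t
  rw [norm_inv, inv_le_iff_one_le_mul₀ (norm_pos_iff.2 h0), mul_assoc, ← norm_mul]
  have := le_abs_self (h t * s t)
  rw [Real.norm_eq_abs]
  linarith

/-- A family of square matrices that are orthogonal up to a vanishing error is eventually
invertible, with bounded inverses. -/
theorem isBigO_inv_of_approx_orthogonal {κ : Type*} [Fintype κ] [DecidableEq κ]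
    {W : T → Matrix κ κ ℝ} (hW : Tendsto (fun t => ‖(W t)ᵀ * W t - 1‖) l (𝓝 0))
    (hW1 : W =O[l] fun _ => (1 : ℝ)) :
    (fun t => (W t)⁻¹) =O[l] (fun _ => (1 : ℝ)) ∧ ∀ᶠ t in l, W t * (W t)⁻¹ = 1 := by
  have hsmall := hW.eventually (gt_mem_nhds (show (0 : ℝ) < 1 / 2 by norm_num))
  have hunit : ∀ᶠ t in l, IsUnit (W t).det := by
    filter_upwards [hsmall] with t ht
    have : IsUnit (1 - (1 - (W t)ᵀ * W t)) := by
      apply isUnit_one_sub_of_norm_lt_one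
      rw [norm_sub_rev]; linarith
    rw [sub_sub_cancel, isUnit_iff_isUnit_det, det_mul] at this
    exact isUnit_of_mul_isUnit_right this
  refine ⟨IsBigO.trans (IsBigO.of_bound 2 ?_) hW1.matrix_transpose, ?_⟩
  · filter_upwards [hsmall, hunit] with t ht hu
    -- The inverse reappears on the right with a factor below `1/2` and is absorbed, so `‖W⁻¹‖ ≤ 2
    -- ‖Wᵀ‖`.
    have e : (W t)⁻¹ = (W t)ᵀ - ((W t)ᵀ * W t - 1) * (W t)⁻¹ := by
      rw [Matrix.sub_mul, Matrix.mul_assoc, mul_nonsing_inv _ hu]; simp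
    have h1 : ‖(W t)⁻¹‖ ≤ ‖(W t)ᵀ‖ + ‖(W t)ᵀ * W t - 1‖ * ‖(W t)⁻¹‖ := by
      conv_lhs => rw [e]
      exact (norm_sub_le _ _).trans (by gcongr; exact norm_mul_le _ _)
    nlinarith [norm_nonneg (W t)⁻¹]
  · filter_upwards [hunit] with t hu
    exact mul_nonsing_inv _ hu

theorem col_mul {ι κ τ : Type*} [Fintype κ] (M : Matrix ι κ ℝ)
    (N : Matrix κ τ ℝ) (j : τ) : (M * N).col j = M *ᵥ N.col j := by
  ext i; simp [Matrix.mul_apply, mulVec, dotProduct]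

theorem col_mul_diagonal {ι κ : Type*} [Fintype κ] [DecidableEq κ] (M : Matrix ι κ ℝ)
    (d : κ → ℝ) (j : κ) : (M * diagonal d).col j = d j • M.col j := by
  ext i; simp [mul_comm]

theorem isBigO_toRows₁ {ι ι' κ : Type*} [Fintype ι] [Fintype ι'] [Fintype κ] [DecidableEq ι]
    [DecidableEq ι'] [DecidableEq κ] {f : T → Matrix (ι ⊕ ι') κ ℝ} {g : T → ℝ} (h : f =O[l] g) :
    (fun t => toRows₁ (f t)) =O[l] g := by
  rw [isBigO_matrix] at *
  exact fun i j => h (Sum.inl i) j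

theorem isBigO_toRows₂ {ι ι' κ : Type*} [Fintype ι] [Fintype ι'] [Fintype κ] [DecidableEq ι]
    [DecidableEq ι'] [DecidableEq κ] {f : T → Matrix (ι ⊕ ι') κ ℝ} {g : T → ℝ} (h : f =O[l] g) :
    (fun t => toRows₂ (f t)) =O[l] g := by
  rw [isBigO_matrix] at *
  exact fun i j => h (Sum.inr i) j

end BigO

namespace Run

variable {m n p k : ℕ} {η ρ : ℝ} {l : Filter (Run m n p k η ρ)}

/-! ### The computed decompositions -/

theorem ε_isBigO (hk : 1 ≤ k) : (fun t : Run m n p k η ρ => t.ε) =O[l] fun t => t.κ * t.ε :=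
  ((one_isBigO_κ hk).mul (isBigO_refl _ l)).congr_left fun _ => one_mul _

theorem isBigO_of_norm_le {E : Type*} [SeminormedAddCommGroup E] {f : Run m n p k η ρ → E}
    (h : ∀ t, ‖f t‖ ≤ η * t.ε) : f =O[l] fun t => t.ε :=
  IsBigO.of_bound η (Eventually.of_forall fun t => by
    rw [Real.norm_of_nonneg t.ε_pos.le]; exact h t)

theorem isBigO_of_norm_le' (hk : 1 ≤ k) {E : Type*} [SeminormedAddCommGroup E]
    {f : Run m n p k η ρ → E} (h : ∀ t, ‖f t‖ ≤ η * ((1 + t.κ) * t.ε)) :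
    f =O[l] fun t => t.κ * t.ε := by
  have h1 : (fun t : Run m n p k η ρ => (1 + t.κ) * t.ε) =O[l] fun t => t.κ * t.ε :=
    ((one_isBigO_κ hk).add (isBigO_refl _ l)).mul (isBigO_refl _ l)
  refine IsBigO.trans (IsBigO.of_bound η (Eventually.of_forall fun t => ?_)) h1
  rw [Real.norm_of_nonneg (mul_nonneg (add_nonneg zero_le_one t.κ_nonneg) t.ε_pos.le)]
  exact h t

theorem svd_B : (fun t : Run m n p k η ρ => t.X.B k - t.P * diagonal t.c * t.Wᵀ) =O[l]
    fun t => t.ε := isBigO_of_norm_le fun t => t.gsvd.svd_B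

theorem orth_P : (fun t : Run m n p k η ρ => t.Pᵀ * t.P - 1) =O[l] fun t => t.ε :=
  isBigO_of_norm_le fun t => t.gsvd.orth_P

theorem orth_W : (fun t : Run m n p k η ρ => t.Wᵀ * t.W - 1) =O[l] fun t => t.ε :=
  isBigO_of_norm_le fun t => t.gsvd.orth_W

theorem svd_Bbar (hk : 1 ≤ k) : (fun t : Run m n p k η ρ =>
    t.X.Bbar k - t.Pbar * diagonal t.s * t.Wᵀ) =O[l] fun t => t.κ * t.ε :=
  isBigO_of_norm_le' hk fun t => t.gsvd.svd_Bbar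

theorem orth_Pbar (hk : 1 ≤ k) : (fun t : Run m n p k η ρ => t.Pbarᵀ * t.Pbar - 1) =O[l]
    fun t => t.κ * t.ε := isBigO_of_norm_le' hk fun t => t.gsvd.orth_Pbar

theorem sq_add_sq (hk : 1 ≤ k) (i : Fin k) : (fun t : Run m n p k η ρ =>
    t.c i ^ 2 + t.s i ^ 2 - 1) =O[l] fun t => t.κ * t.ε :=
  isBigO_of_norm_le' hk fun t => t.gsvd.normalized i

theorem P_isBigO : (fun t : Run m n p k η ρ => t.P) =O[l] fun _ => (1 : ℝ) :=
  isBigO_of_transpose_mul_self (((orth_P.trans ε_isBigO_one).add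
    (isBigO_const_const 1 one_ne_zero _)).congr_left fun _ => sub_add_cancel _ _)

theorem W_isBigO : (fun t : Run m n p k η ρ => t.W) =O[l] fun _ => (1 : ℝ) :=
  isBigO_of_transpose_mul_self (((orth_W.trans ε_isBigO_one).add
    (isBigO_const_const 1 one_ne_zero _)).congr_left fun _ => sub_add_cancel _ _)

/-- The size of the entries of the computed decompositions in the absence of smallness
assumptions. -/
def N (t : Run m n p k η ρ) : ℝ := 1 + t.κ * t.ε

theorem κ_mul_ε_nonneg (t : Run m n p k η ρ) : 0 ≤ t.κ * t.ε := mul_nonneg t.κ_nonneg t.ε_pos.le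

theorem one_isBigO_N : (fun _ : Run m n p k η ρ => (1 : ℝ)) =O[l] N :=
  IsBigO.of_bound 1 (Eventually.of_forall fun t => by
    have := t.κ_mul_ε_nonneg
    rw [N, Real.norm_of_nonneg (add_nonneg zero_le_one this), norm_one]; linarith)

theorem κ_mul_ε_isBigO_N : (fun t : Run m n p k η ρ => t.κ * t.ε) =O[l] N :=
  IsBigO.of_bound 1 (Eventually.of_forall fun t => by
    have := t.κ_mul_ε_nonneg
    rw [N, Real.norm_of_nonneg (add_nonneg zero_le_one this), Real.norm_of_nonneg this]
    linarith)

theorem sq_add_sq_isBigO_N (hk : 1 ≤ k) (i : Fin k) :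
    (fun t : Run m n p k η ρ => t.c i ^ 2 + t.s i ^ 2) =O[l] N :=
  (((sq_add_sq hk i).trans κ_mul_ε_isBigO_N).add one_isBigO_N).congr_left
    fun _ => sub_add_cancel _ _

theorem c_sq_isBigO_N (hk : 1 ≤ k) (i : Fin k) :
    (fun t : Run m n p k η ρ => t.c i ^ 2) =O[l] N := by
  refine IsBigO.trans (IsBigO.of_bound 1 (Eventually.of_forall fun t => ?_))
    (sq_add_sq_isBigO_N hk i)
  rw [Real.norm_of_nonneg (by positivity), Real.norm_of_nonneg (by positivity)]
  nlinarith [sq_nonneg (t.s i)]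

theorem s_sq_isBigO_N (hk : 1 ≤ k) (i : Fin k) :
    (fun t : Run m n p k η ρ => t.s i ^ 2) =O[l] N := by
  refine IsBigO.trans (IsBigO.of_bound 1 (Eventually.of_forall fun t => ?_))
    (sq_add_sq_isBigO_N hk i)
  rw [Real.norm_of_nonneg (by positivity), Real.norm_of_nonneg (by positivity)]
  nlinarith [sq_nonneg (t.c i)]

theorem Pbar_sq_isBigO_N (hk : 1 ≤ k) (i j : Fin k) :
    (fun t : Run m n p k η ρ => t.Pbar i j ^ 2) =O[l] N := by
  refine isBigO_sq_entry ?_ i j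
  exact (((orth_Pbar hk).trans κ_mul_ε_isBigO_N).add
    ((isBigO_const_const 1 one_ne_zero _).trans one_isBigO_N)).congr_left
      fun _ => sub_add_cancel _ _

theorem one_sq_isBigO_N : (fun _ : Run m n p k η ρ => (1 : ℝ) ^ 2) =O[l] N := by
  simpa only [one_pow] using one_isBigO_N

theorem c_isBigO_N (hk : 1 ≤ k) (i : Fin k) : (fun t : Run m n p k η ρ => t.c i) =O[l] N :=
  (isBigO_mul_of_sq (c_sq_isBigO_N hk i) one_sq_isBigO_N).congr_left fun _ => mul_one _

theorem s_isBigO_N (hk : 1 ≤ k) (i : Fin k) : (fun t : Run m n p k η ρ => t.s i) =O[l] N :=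
  (isBigO_mul_of_sq (s_sq_isBigO_N hk i) one_sq_isBigO_N).congr_left fun _ => mul_one _

/-! ### The three blocks of the residual -/

/-- `V_k = Qᵀ V'_k`. -/
def Vn (t : Run m n p k η ρ) : Matrix (Fin n) (Fin k) ℝ := t.Qᵀ * t.X.V k

/-- The first `m` rows of `Q`. -/
def QA (t : Run m n p k η ρ) : Matrix (Fin m) (Fin n) ℝ := toRows₁ t.Q

/-- The last `p` rows of `Q`. -/
def QL (t : Run m n p k η ρ) : Matrix (Fin p) (Fin n) ℝ := toRows₂ t.Q

/-- The first block of the residual. -/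
def res₁ (t : Run m n p k η ρ) (i : Fin k) : Fin m → ℝ :=
  (t.QA * t.Vn * t.W - t.X.U k * (t.P * diagonal t.c)).col i

/-- The second block of the residual. -/
def res₂ (t : Run m n p k η ρ) (i : Fin k) : Fin p → ℝ :=
  (t.QL * t.Vn * t.W - t.X.Uhat k * (t.Pbar * diagonal t.s)).col i

/-- The third block of the residual, up to multiplication by `Rᵀ`. -/
def res₃ (t : Run m n p k η ρ) (i : Fin k) : Fin n → ℝ :=
  (t.QAᵀ * t.X.U k * (t.P * diagonal t.s) - t.QLᵀ * t.X.Uhat k * (t.Pbar * diagonal t.c)).col i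

theorem jbdResidual_eq (t : Run m n p k η ρ) (i : Fin k) :
    jbdResidual t.A t.L t.Q t.R t.X k (t.c i) (t.s i) (t.W.col i) (t.P.col i) (t.Pbar.col i) =
      Sum.elim (t.res₁ i) (Sum.elim (t.res₂ i) (t.Rᵀ *ᵥ t.res₃ i)) := by
  have hR : ∀ x, t.R *ᵥ (t.R⁻¹ *ᵥ x) = x := fun x => by
    rw [mulVec_mulVec, mul_nonsing_inv _ t.qr.isUnit_det, one_mulVec]
  have col_sub : ∀ {ι κ : Type} (M M' : Matrix ι κ ℝ) (j : κ),
    (M - M').col j = M.col j - M'.col j := fun _ _ _ => rfl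
  unfold jbdResidual residual res₁ res₂ res₃
  congr 1
  · rw [col_sub, col_mul, col_mul, col_mul_diagonal, mulVec_smul, t.qr.A_eq,
      ← mulVec_mulVec (M := toRows₁ t.Q), hR, mulVec_mulVec]
    rfl
  congr 1
  · rw [col_sub, col_mul, col_mul, col_mul_diagonal, mulVec_smul, t.qr.L_eq,
      ← mulVec_mulVec (M := toRows₂ t.Q), hR, mulVec_mulVec]
    rfl
  · rw [col_sub, col_mul (_ * _) (t.P * _), col_mul (_ * _) (t.Pbar * _), col_mul_diagonal,
      col_mul_diagonal, mulVec_smul, mulVec_smul, mulVec_sub, mulVec_smul, mulVec_smul, mulVec_mulVec, mulVec_mulVec, mulVec_mulVec,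
      mulVec_mulVec, ← Matrix.mul_assoc, ← Matrix.mul_assoc, ← transpose_mul, ← transpose_mul, QA,
      QL, ← t.qr.A_eq, ← t.qr.L_eq]

theorem QA_isBigO : (fun t : Run m n p k η ρ => t.QA) =O[l] fun _ => (1 : ℝ) :=
  isBigO_toRows₁ Q_isBigO

theorem QL_isBigO : (fun t : Run m n p k η ρ => t.QL) =O[l] fun _ => (1 : ℝ) :=
  isBigO_toRows₂ Q_isBigO

theorem Vn_isBigO : (fun t : Run m n p k η ρ => t.Vn) =O[l] fun _ => (1 : ℝ) :=
  (Q_isBigO.matrix_transpose.matrix_mul V_isBigO).congr_right fun _ => mul_one _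

theorem P_mul_diagonal_isBigO_N {d : Run m n p k η ρ → Fin k → ℝ}
    (hd : ∀ i, (fun t => d t i) =O[l] N) :
    (fun t : Run m n p k η ρ => t.P * diagonal (d t)) =O[l] N :=
  (P_isBigO.matrix_mul (isBigO_diagonal hd)).congr_right fun _ => one_mul _

theorem Pbar_mul_diagonal_isBigO_N (hk : 1 ≤ k) {d : Run m n p k η ρ → Fin k → ℝ}
    (hd : ∀ i, (fun t => d t i ^ 2) =O[l] N) :
    (fun t : Run m n p k η ρ => t.Pbar * diagonal (d t)) =O[l] N := by
  rw [isBigO_matrix]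
  intro i j
  simp only [mul_diagonal]
  exact isBigO_mul_of_sq (Pbar_sq_isBigO_N hk i j) (hd j)

theorem res₁_isBigO_N (hk : 1 ≤ k) (i : Fin k) :
    (fun t : Run m n p k η ρ => t.res₁ i) =O[l] N := by
  refine isBigO_col (IsBigO.sub ?_ ?_) i
  · exact (((QA_isBigO.matrix_mul Vn_isBigO).matrix_mul W_isBigO).congr_right
      fun _ => by ring).trans one_isBigO_N
  · exact (U_isBigO.matrix_mul (P_mul_diagonal_isBigO_N (c_isBigO_N hk))).congr_right
      fun _ => one_mul _

theorem res₂_isBigO_N (hk : 1 ≤ k) (i : Fin k) :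
    (fun t : Run m n p k η ρ => t.res₂ i) =O[l] N := by
  refine isBigO_col (IsBigO.sub ?_ ?_) i
  · exact (((QL_isBigO.matrix_mul Vn_isBigO).matrix_mul W_isBigO).congr_right
      fun _ => by ring).trans one_isBigO_N
  · exact (Uhat_isBigO.matrix_mul (Pbar_mul_diagonal_isBigO_N hk (s_sq_isBigO_N hk))).congr_right
      fun _ => one_mul _

theorem res₃_isBigO_N (hk : 1 ≤ k) (i : Fin k) :
    (fun t : Run m n p k η ρ => t.res₃ i) =O[l] N := by
  refine isBigO_col (IsBigO.sub ?_ ?_) i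
  · exact ((QA_isBigO.matrix_transpose.matrix_mul U_isBigO).matrix_mul
      (P_mul_diagonal_isBigO_N (s_isBigO_N hk))).congr_right fun _ => by ring
  · exact ((QL_isBigO.matrix_transpose.matrix_mul Uhat_isBigO).matrix_mul
      (Pbar_mul_diagonal_isBigO_N hk (c_sq_isBigO_N hk))).congr_right fun _ => by ring

/-! ### The regime of small errors -/

/-- The size of the errors in the residual bounds. -/
def θ (t : Run m n p k η ρ) : ℝ := t.κ * t.κh * t.ε

theorem θ_nonneg (t : Run m n p k η ρ) : 0 ≤ t.θ :=
  mul_nonneg (mul_nonneg t.κ_nonneg t.κh_nonneg) t.ε_pos.le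

theorem κ_mul_ε_isBigO_θ (hk : 1 ≤ k) : (fun t : Run m n p k η ρ => t.κ * t.ε) =O[l] θ :=
  ((one_isBigO_κh hk).mul (isBigO_refl (fun t => t.κ * t.ε) l)).congr (fun _ => one_mul _)
    fun t => by rw [θ]; ring

theorem κh_mul_ε_isBigO_θ (hk : 1 ≤ k) : (fun t : Run m n p k η ρ => t.κh * t.ε) =O[l] θ :=
  ((one_isBigO_κ hk).mul (isBigO_refl (fun t => t.κh * t.ε) l)).congr (fun _ => one_mul _)
    fun t => by rw [θ]; ring

theorem ε_isBigO_θ (hk : 1 ≤ k) : (fun t : Run m n p k η ρ => t.ε) =O[l] θ :=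
  (ε_isBigO hk).trans (κ_mul_ε_isBigO_θ hk)

section Small

variable (hk : 1 ≤ k) (hθ : Tendsto (fun t : Run m n p k η ρ => t.θ) l (𝓝 0))

include hk hθ

theorem N_isBigO_one : N =O[l] fun _ : Run m n p k η ρ => (1 : ℝ) :=
  (isBigO_const_const 1 one_ne_zero _).add ((κ_mul_ε_isBigO_θ hk).trans (hθ.isBigO_one ℝ))

theorem c_isBigO (i : Fin k) : (fun t : Run m n p k η ρ => t.c i) =O[l] fun _ => (1 : ℝ) :=
  (c_isBigO_N hk i).trans (N_isBigO_one hk hθ)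

theorem s_isBigO (i : Fin k) : (fun t : Run m n p k η ρ => t.s i) =O[l] fun _ => (1 : ℝ) :=
  (s_isBigO_N hk i).trans (N_isBigO_one hk hθ)

theorem Pbar_isBigO : (fun t : Run m n p k η ρ => t.Pbar) =O[l] fun _ => (1 : ℝ) :=
  isBigO_of_transpose_mul_self ((((orth_Pbar hk).trans (κ_mul_ε_isBigO_θ hk)).trans
    (hθ.isBigO_one ℝ)).add (isBigO_const_const 1 one_ne_zero _) |>.congr_left
      fun _ => sub_add_cancel _ _)

theorem Bbar_isBigO : (fun t : Run m n p k η ρ => t.X.Bbar k) =O[l] fun _ => (1 : ℝ) := by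
  have h1 := ((Pbar_isBigO hk hθ).matrix_mul (isBigO_diagonal (s_isBigO hk hθ))).matrix_mul
    W_isBigO.matrix_transpose
  have h2 := ((svd_Bbar hk).trans (κ_mul_ε_isBigO_θ hk)).trans (hθ.isBigO_one ℝ)
  exact (h2.add (h1.congr_right fun _ => by ring)).congr_left fun _ => sub_add_cancel _ _

/-- For `i < k` the number `± β̂_i` is an entry of `B̄_k`, which is bounded by its computed
decomposition. The last one, `β̂_k`, lies outside `B̄_k` and needs a separate argument. -/
theorem βh_isBigO (i : ℕ) (h1 : 1 ≤ i) (hi : i < k) :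
    (fun t : Run m n p k η ρ => t.X.βh i) =O[l] fun _ => (1 : ℝ) := by
  have h := Bbar_isBigO hk hθ
  rw [isBigO_matrix] at h
  refine ((h ⟨i - 1, by omega⟩ ⟨i, hi⟩).const_mul_left ((-1) ^ i)).congr_left fun t => ?_
  have e : t.X.Bbar k ⟨i - 1, by omega⟩ ⟨i, hi⟩ = t.X.βh i * (-1) ^ i := by
    rw [Data.Bbar, mul_diagonal]
    simp only [Data.Bhat]
    rw [if_neg (by omega), if_pos (by omega), Nat.sub_add_cancel h1]
  have e2 : ((-1 : ℝ) ^ i) * (-1) ^ i = 1 := by rw [← mul_pow]; simp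
  rw [e]
  linear_combination t.X.βh i * e2

theorem B_gsvd : (fun t : Run m n p k η ρ => t.X.B k * t.W - t.P * diagonal t.c) =O[l]
      (fun t => t.ε) ∧
    (fun t : Run m n p k η ρ => (t.X.B k)ᵀ * t.P - t.W * diagonal t.c) =O[l] fun t => t.ε :=
  isBigO_of_approx_svd svd_B orth_P orth_W P_isBigO W_isBigO (c_isBigO hk hθ)

theorem Bbar_gsvd : (fun t : Run m n p k η ρ => t.X.Bbar k * t.W - t.Pbar * diagonal t.s) =O[l]
      (fun t => t.κ * t.ε) ∧
    (fun t : Run m n p k η ρ => (t.X.Bbar k)ᵀ * t.Pbar - t.W * diagonal t.s) =O[l]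
      fun t => t.κ * t.ε :=
  isBigO_of_approx_svd (svd_Bbar hk) (orth_Pbar hk) (orth_W.trans (ε_isBigO hk))
    (Pbar_isBigO hk hθ) W_isBigO (s_isBigO hk hθ)

/-- The common right factor gives `(Bᵀ B + B̄ᵀ B̄) W ≈ W (Θ² + Ψ²) ≈ W`, and `W` is eventually
invertible with bounded inverse. -/
theorem gram_isBigO : (fun t : Run m n p k η ρ =>
    (t.X.B k)ᵀ * t.X.B k + (t.X.Bbar k)ᵀ * t.X.Bbar k - 1) =O[l] fun t => t.κ * t.ε := by
  obtain ⟨hinv, hunit⟩ := isBigO_inv_of_approx_orthogonal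
    (((orth_W (l := l)).norm_left.trans (ε_isBigO_θ hk)).trans_tendsto hθ) W_isBigO
  have hε := ε_isBigO (l := l) (m := m) (n := n) (p := p) (η := η) (ρ := ρ) hk
  have hc := isBigO_diagonal (c_isBigO hk hθ)
  have hs := isBigO_diagonal (s_isBigO hk hθ)
  have h1 : (fun t : Run m n p k η ρ => (t.X.B k)ᵀ * (t.X.B k * t.W) -
      t.W * (diagonal t.c * diagonal t.c)) =O[l] fun t => t.κ * t.ε := by
    have a1 := ((B_isBigO.matrix_transpose.matrix_mul (B_gsvd hk hθ).1).congr_right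
      fun _ => one_mul _).trans hε
    have a2 := (((B_gsvd hk hθ).2.matrix_mul hc).congr_right fun _ => mul_one _).trans hε
    refine (a1.add a2).congr_left fun t => ?_
    rw [Matrix.mul_sub, Matrix.sub_mul]
    simp only [Matrix.mul_assoc]
    abel
  have h2 : (fun t : Run m n p k η ρ => (t.X.Bbar k)ᵀ * (t.X.Bbar k * t.W) -
      t.W * (diagonal t.s * diagonal t.s)) =O[l] fun t => t.κ * t.ε := by
    have a1 := (((Bbar_isBigO hk hθ).matrix_transpose.matrix_mul (Bbar_gsvd hk hθ).1).congr_right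
      fun _ => one_mul _)
    have a2 := (((Bbar_gsvd hk hθ).2.matrix_mul hs).congr_right fun _ => mul_one _)
    refine (a1.add a2).congr_left fun t => ?_
    rw [Matrix.mul_sub, Matrix.sub_mul]
    simp only [Matrix.mul_assoc]
    abel
  have h3 : (fun t : Run m n p k η ρ => t.W * (diagonal t.c * diagonal t.c +
      diagonal t.s * diagonal t.s - 1)) =O[l] fun t => t.κ * t.ε := by
    refine (W_isBigO.matrix_mul (isBigO_diagonal (fun i => sq_add_sq hk i))).congr (fun t => ?_)
      fun _ => one_mul _
    congr 1
    rw [diagonal_mul_diagonal, diagonal_mul_diagonal, diagonal_add, ← diagonal_one, diagonal_sub]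
    simp only [pow_two]
  have h4 := (((h1.add h2).add h3).matrix_mul hinv).congr_right fun _ => mul_one _
  refine h4.congr' ?_ EventuallyEq.rfl
  filter_upwards [hunit] with t ht
  have e : (t.X.B k)ᵀ * (t.X.B k * t.W) - t.W * (diagonal t.c * diagonal t.c) +
      ((t.X.Bbar k)ᵀ * (t.X.Bbar k * t.W) - t.W * (diagonal t.s * diagonal t.s)) +
      t.W * (diagonal t.c * diagonal t.c + diagonal t.s * diagonal t.s - 1) =
      ((t.X.B k)ᵀ * t.X.B k + (t.X.Bbar k)ᵀ * t.X.Bbar k - 1) * t.W := by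
    rw [Matrix.mul_sub, Matrix.mul_add, Matrix.sub_mul, Matrix.add_mul, Matrix.mul_one,
      Matrix.one_mul]
    simp only [Matrix.mul_assoc]
    abel
  rw [e, Matrix.mul_assoc, ht, Matrix.mul_one]

end Small

/-! ### The two bidiagonalizations -/

/-- `v_{k+1} = Qᵀ v'_{k+1}`. -/
def q (t : Run m n p k η ρ) : Fin n → ℝ := t.Qᵀ *ᵥ t.X.v (k + 1)

theorem q_isBigO : (fun t : Run m n p k η ρ => t.q) =O[l] fun _ => (1 : ℝ) :=
  (Q_isBigO.matrix_transpose.matrix_mulVec (v_isBigO (by omega) le_rfl)).congr_right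
    fun _ => mul_one _

/-- `Q_A V` consists of the first rows of `Q Qᵀ V'`, which differ from those of `V'` by the drift
`(1 - Q Qᵀ) V'`. -/
theorem QA_mul_Vn (hk : 1 ≤ k) :
    (fun t : Run m n p k η ρ => t.QA * t.Vn - t.X.U k * t.X.B k) =O[l] fun t => t.κ * t.ε := by
  have h1 := isBigO_toRows₁ (one_sub_proj_mul_V (l := l) (m := m) (n := n) (p := p) (k := k)
    (η := η) (ρ := ρ))
  have h2 := (toRows₁_V_sub (l := l) (m := m) (n := n) (p := p) (k := k)
    (η := η) (ρ := ρ)).trans (ε_isBigO hk)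
  refine (h2.sub h1).congr_left fun t => ?_
  have e : toRows₁ ((1 - t.Q * t.Qᵀ) * t.X.V k) = toRows₁ (t.X.V k) - t.QA * t.Vn := by
    rw [Matrix.sub_mul, Matrix.one_mul, Matrix.mul_assoc]
    ext i j
    simp [QA, Vn, Matrix.mul_apply]
  rw [e]
  abel

theorem QL_mul_Vn (hk : 1 ≤ k) (hθ : Tendsto (fun t : Run m n p k η ρ => t.θ) l (𝓝 0)) :
    (fun t : Run m n p k η ρ => t.QL * t.Vn - t.X.Uhat k * t.X.Bbar k) =O[l]
    fun t => t.κ * t.ε := by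
  have h1 := isBigO_toRows₂ (one_sub_proj_mul_V (l := l) (m := m) (n := n) (p := p) (k := k)
    (η := η) (ρ := ρ))
  have h2 := (toRows₂_V_sub (βh_isBigO hk hθ)).trans (ε_isBigO hk)
  refine (h2.sub h1).congr_left fun t => ?_
  have e : toRows₂ ((1 - t.Q * t.Qᵀ) * t.X.V k) = toRows₂ (t.X.V k) - t.QL * t.Vn := by
    rw [Matrix.sub_mul, Matrix.one_mul, Matrix.mul_assoc]
    ext i j
    simp [QL, Vn, Matrix.mul_apply]
  rw [e]
  abel

/-- Multiplying the `V'`-recurrence by `Qᵀ` removes the projection; no inverse is involved, so the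
error stays `O(ε)`. -/
theorem QA_transpose_mul_U : (fun t : Run m n p k η ρ => t.QAᵀ * t.X.U k -
    (t.Vn * (t.X.B k)ᵀ + vecMulVec t.q (Pi.single (Fin.last k) (t.X.α (k + 1))))) =O[l]
      fun t => t.ε := by
  have h := (Q_isBigO.matrix_transpose.matrix_mul (V_mul_B_transpose (l := l) (m := m) (n := n)
    (p := p) (k := k) (η := η) (ρ := ρ))).congr_right fun _ => one_mul _
  refine h.neg_left.congr_left fun t => ?_
  have e : t.Qᵀ * (t.Q * t.Qᵀ * t.U₀) = t.QAᵀ * t.X.U k := by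
    rw [Matrix.mul_assoc t.Q, ← Matrix.mul_assoc, t.qr.orthonormal, Matrix.one_mul]
    ext i j
    simp [QA, U₀, Matrix.mul_apply]
  rw [Matrix.mul_sub, Matrix.mul_add, e, mul_vecMulVec, Vn, q, Matrix.mul_assoc]
  abel

/-- The inverse of `B̄_k`. -/
def BbarInv (t : Run m n p k η ρ) : Matrix (Fin k) (Fin k) ℝ :=
  diagonal (fun j : Fin k => (-1 : ℝ) ^ (j : ℕ)) * (t.X.Bhat k)⁻¹

theorem sign_mul_sign : diagonal (fun j : Fin k => (-1 : ℝ) ^ (j : ℕ)) *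
    diagonal (fun j : Fin k => (-1 : ℝ) ^ (j : ℕ)) = 1 := by
  rw [diagonal_mul_diagonal, ← diagonal_one]
  congr 1
  ext j
  rw [← mul_pow]; simp

theorem Bbar_mul_inv (t : Run m n p k η ρ) : t.X.Bbar k * t.BbarInv = 1 := by
  rw [Data.Bbar, BbarInv, Matrix.mul_assoc, ← Matrix.mul_assoc (diagonal _), sign_mul_sign,
    Matrix.one_mul, mul_nonsing_inv _ t.noBreakdown.isUnit_det_Bhat]

theorem inv_mul_Bbar (t : Run m n p k η ρ) : t.BbarInv * t.X.Bbar k = 1 :=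
  mul_eq_one_comm.1 t.Bbar_mul_inv

theorem BbarInv_isBigO : (fun t : Run m n p k η ρ => t.BbarInv) =O[l] fun t => t.κh :=
  ((isBigO_const_const (diagonal fun j : Fin k => (-1 : ℝ) ^ (j : ℕ)) one_ne_zero
    l).matrix_mul Bhat_inv_isBigO).congr_right fun _ => one_mul _

/-- The row vector that `e_{k+1}ᵀ B_k B̄_k⁻¹`, scaled by `α_{k+1}`, contributes. -/
theorem last_row_isBigO (hk : 1 ≤ k) : (fun t : Run m n p k η ρ =>
    Pi.single (Fin.last k) (t.X.α (k + 1)) ᵥ* t.X.B k ᵥ* t.BbarInv +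
      Pi.single (lastIdx hk) (t.X.βbar k)) =O[l] fun t => t.κh * t.ε := by
  have hv := val_lastIdx hk
  rw [isBigO_pi]
  intro j
  -- The last row of `B̂_k⁻¹` is `e_kᵀ / α̂_k`, so the row vector is zero except in its last entry,
  -- where the error is that of `α̂_k β̂_k ≈ α_{k+1} β_{k+1}` divided by `α̂_k`.
  have h := ((αh_inv_isBigO hk).mul (βh_rec (l := l) (m := m) (n := n) (p := p) (η := η) (ρ := ρ)
    hk le_rfl).2).const_mul_left (if j = (lastIdx hk) then -((-1) ^ (k - 1)) else 0)
  refine h.congr_left fun t => ?_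
  have e1 : Pi.single (Fin.last k) (t.X.α (k + 1)) ᵥ* t.X.B k =
      Pi.single (lastIdx hk) (t.X.α (k + 1) * t.X.β (k + 1)) := by
    ext i
    rw [single_vecMul]
    simp only [Pi.smul_apply, Matrix.row, smul_eq_mul, Data.B, Fin.val_last]
    rw [if_neg (by omega)]
    by_cases hi : i = (lastIdx hk)
    · subst hi
      simp only [Pi.single_eq_same]
      rw [if_pos (by omega), show (lastIdx hk : ℕ) + 2 = k + 1 by omega]
    · rw [Pi.single_eq_of_ne hi, if_neg, mul_zero]
      intro h
      exact hi (Fin.ext (by simp; omega))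
  have e2 : t.BbarInv (lastIdx hk) j =
      (-1) ^ (k - 1) * (if j = (lastIdx hk) then (t.X.αh k)⁻¹ else 0) := by
    have h1 := t.Bhat_inv_last_row hk j
    have h2 := (t.noBreakdown.1 k hk le_rfl).2
    rw [BbarInv, diagonal_mul]
    congr 1
    rw [← mul_right_inj' h2, h1]
    split_ifs
    · field_simp
    · simp
  rw [e1, single_vecMul]
  simp only [Pi.add_apply, Pi.smul_apply, Matrix.row, smul_eq_mul, e2, Data.βbar]
  have h2 := (t.noBreakdown.1 k hk le_rfl).2
  by_cases hj : j = (lastIdx hk)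
  · subst hj
    simp only [if_true, Pi.single_eq_same]
    have e3 : (-1 : ℝ) ^ k = - (-1) ^ (k - 1) := by
      obtain ⟨k', rfl⟩ : ∃ k', k = k' + 1 := ⟨k - 1, by omega⟩
      simp [pow_succ]
    rw [e3]
    field_simp
    ring
  · simp [hj]

/-! ### The adjoint relation for `L` and the size of `β̂_k`, for small errors -/

section Small

variable (hk : 1 ≤ k) (hθ : Tendsto (fun t : Run m n p k η ρ => t.θ) l (𝓝 0))

include hk hθ

/-- `Q_Lᵀ Û B̄ ≈ Q_Lᵀ Q_L V = V - Q_Aᵀ Q_A V ≈ V - Q_Aᵀ U B ≈ V (1 - Bᵀ B) - α_{k+1} q e_{k+1}ᵀ B`,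
and `1 - Bᵀ B ≈ B̄ᵀ B̄`. -/
theorem QL_transpose_mul_Uhat_mul_Bbar : (fun t : Run m n p k η ρ =>
    t.QLᵀ * t.X.Uhat k * t.X.Bbar k - (t.Vn * ((t.X.Bbar k)ᵀ * t.X.Bbar k) -
      vecMulVec t.q (Pi.single (Fin.last k) (t.X.α (k + 1)) ᵥ* t.X.B k))) =O[l]
        fun t => t.κ * t.ε := by
  have h1 := (QL_isBigO.matrix_transpose.matrix_mul (QL_mul_Vn hk hθ)).congr_right
    fun _ => one_mul _
  have h2 := (QA_isBigO.matrix_transpose.matrix_mul (QA_mul_Vn (l := l) (m := m) (n := n) (p := p)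
    (η := η) (ρ := ρ) hk)).congr_right fun _ => one_mul _
  have h3 := ((QA_transpose_mul_U.matrix_mul B_isBigO).congr_right fun _ => mul_one _).trans
    (ε_isBigO (l := l) (m := m) (n := n) (p := p) (η := η) (ρ := ρ) hk)
  have h4 := (Vn_isBigO.matrix_mul (gram_isBigO hk hθ)).congr_right fun _ => one_mul _
  refine (((h1.add h2).add h3).add h4).neg_left.congr_left fun t => ?_
  have e : t.QLᵀ * (t.QL * t.Vn) = t.Vn - t.QAᵀ * (t.QA * t.Vn) := by
    rw [eq_sub_iff_add_eq, ← Matrix.mul_assoc, ← Matrix.mul_assoc, ← Matrix.add_mul, add_comm]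
    rw [QA, QL, t.qr.toRows_mul_add, Matrix.one_mul]
  rw [Matrix.mul_sub, Matrix.mul_sub, Matrix.sub_mul, Matrix.add_mul, Matrix.mul_sub,
    Matrix.mul_add, Matrix.mul_one, e, vecMulVec_mul]
  simp only [Matrix.mul_assoc]
  abel

/-- Cancelling `B̄` on the right turns the error `κ ε` into `θ`; `last_row_isBigO` identifies the
remaining rank-one term. -/
theorem QL_transpose_mul_Uhat : (fun t : Run m n p k η ρ => t.QLᵀ * t.X.Uhat k -
    (t.Vn * (t.X.Bbar k)ᵀ + vecMulVec t.q (Pi.single (lastIdx hk) (t.X.βbar k)))) =O[l]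
      θ := by
  have h1 := ((QL_transpose_mul_Uhat_mul_Bbar hk hθ).matrix_mul BbarInv_isBigO).congr_right
    (g₂ := θ) fun t => by rw [θ]; ring
  have h2 := ((isBigO_vecMulVec q_isBigO (last_row_isBigO (l := l) (m := m) (n := n) (p := p)
    (η := η) (ρ := ρ) hk)).congr_right fun _ => one_mul _).trans (κh_mul_ε_isBigO_θ hk)
  refine (h1.sub h2).congr_left fun t => ?_
  rw [Matrix.sub_mul, Matrix.sub_mul, Matrix.mul_assoc _ _ t.BbarInv, t.Bbar_mul_inv,
    Matrix.mul_one, Matrix.mul_assoc _ _ t.BbarInv, Matrix.mul_assoc _ _ t.BbarInv,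
    t.Bbar_mul_inv, Matrix.mul_one, vecMulVec_mul, vecMulVec_add]
  abel

/-- Split `v'_{k+1}` by `Q Qᵀ`. In the last column of the relation for `Q_Lᵀ Û`, everything but
`β̄_k q` is bounded, which handles the projected part. For the other part, `β̂_k = O(κ̂ α_{k+1})`
meets the drift bound that carries `α_{k+1}`, and the result is `O(θ)`. -/
theorem βh_last_smul_v_isBigO :
    (fun t : Run m n p k η ρ => t.X.βh k • t.X.v (k + 1)) =O[l] fun _ => (1 : ℝ) := by
  have hq : (fun t : Run m n p k η ρ => t.X.βh k • t.q) =O[l] fun _ => (1 : ℝ) := by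
    have h1 := (QL_transpose_mul_Uhat hk hθ).trans (hθ.isBigO_one ℝ)
    have h2 := (QL_isBigO (l := l) (m := m) (n := n) (p := p) (k := k) (η := η)
      (ρ := ρ)).matrix_transpose.matrix_mul Uhat_isBigO |>.congr_right fun _ => mul_one _
    have h3 := (Vn_isBigO.matrix_mul (Bbar_isBigO hk hθ).matrix_transpose).congr_right
      fun _ => mul_one _
    have h4 := isBigO_col ((h2.sub h3).sub h1) (lastIdx hk)
    refine (h4.const_smul_left ((-1 : ℝ) ^ k)).congr_left fun t => ?_
    ext a
    have e : ((-1 : ℝ) ^ k) * (-1) ^ k = 1 := by rw [← mul_pow]; simp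
    simp only [Pi.smul_apply, col_apply, Matrix.sub_apply, Matrix.add_apply, vecMulVec_apply,
      Pi.single_eq_same, smul_eq_mul, Data.βbar]
    linear_combination t.X.βh k * t.q a * e
  have h5 : (fun t : Run m n p k η ρ => t.Q *ᵥ (t.X.βh k • t.q)) =O[l] fun _ => (1 : ℝ) :=
    (Q_isBigO.matrix_mulVec hq).congr_right fun _ => one_mul _
  have h6 : (fun t : Run m n p k η ρ => t.X.βh k • ((1 - t.Q * t.Qᵀ) *ᵥ t.X.v (k + 1))) =O[l]
      fun _ => (1 : ℝ) := by
    have h7 := (βh_last_isBigO (l := l) (m := m) (n := n) (p := p) (η := η) (ρ := ρ) hk).smul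
      (isBigO_refl (fun t : Run m n p k η ρ => (1 - t.Q * t.Qᵀ) *ᵥ t.X.v (k + 1)) l)
    have h8 := (isBigO_refl (fun t : Run m n p k η ρ => t.κh) l).smul
      (one_sub_proj_mulVec_v (l := l) (m := m) (n := n) (p := p) (η := η) (ρ := ρ) hk)
    have h9 := (h7.congr_right fun t => mul_smul _ _ _).trans h8
    exact (h9.congr_right (g₂ := θ) fun t => by rw [θ, smul_eq_mul]; ring).trans
      (hθ.isBigO_one ℝ)
  refine (h5.add h6).congr_left fun t => ?_
  rw [q, mulVec_smul, mulVec_mulVec, Matrix.sub_mulVec, one_mulVec, smul_sub]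
  abel

/-- If `α_{k+1} ≠ 0`, then `v'_{k+1}` has norm at least `1/2` for small `ε` and can be divided out;
if `α_{k+1} = 0`, then `β̂_k = 0` as well. -/
theorem βh_last_isBigO_one :
    (fun t : Run m n p k η ρ => t.X.βh k) =O[l] fun _ => (1 : ℝ) := by
  refine IsBigO.trans ?_ ((isBigO_toLp _).trans (βh_last_smul_v_isBigO hk hθ))
  choose g r hg hr hn using fun t : Run m n p k η ρ => t.computed.v_step k hk le_rfl
  obtain ⟨K, hK, H⟩ := FlNormalize.bounds (Fin m ⊕ Fin p)
  have hε : Tendsto (fun t : Run m n p k η ρ => t.ε) l (𝓝 0) := (ε_isBigO_θ hk).trans_tendsto hθ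
  have hsmall := (hε.const_mul K).eventually (gt_mem_nhds (show K * 0 < 1 / 2 by norm_num))
  obtain ⟨C, hC⟩ := (βh_last_isBigO (l := l) (m := m) (n := n) (p := p) (η := η) (ρ := ρ) hk).bound
  refine IsBigO.of_bound 2 ?_
  filter_upwards [hsmall, hC] with t ht hCt
  by_cases hα : t.X.α (k + 1) = 0
  · have : t.X.βh k = 0 := by simpa [hα] using hCt
    simp [this]
  · have h1 := (H t.ε t.ε_pos t.ε_le _ _ _ (hn t)).2.2.2 hα
    have h2 : 1 ≤ 2 * ‖WithLp.toLp 2 (t.X.v (k + 1))‖ := by linarith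
    rw [WithLp.toLp_smul, norm_smul]
    nlinarith [norm_nonneg (t.X.βh k)]

/-- `Wᵀ B̄⁻¹ P̄ Ψ ≈ Wᵀ W ≈ 1`, so on the diagonal `s_i` times an `O(κ̂)` quantity tends to 1. -/
theorem s_inv_isBigO (i : Fin k) :
    (fun t : Run m n p k η ρ => (t.s i)⁻¹) =O[l] fun t => t.κh := by
  have h0 := ((W_isBigO (l := l)).matrix_transpose.matrix_mul
    (BbarInv_isBigO.matrix_mul (Pbar_isBigO hk hθ))).congr_right fun t => by
      rw [one_mul, mul_one]
  have h1 := (W_isBigO.matrix_transpose.matrix_mul (BbarInv_isBigO.matrix_mul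
    (Bbar_gsvd hk hθ).1)).congr_right (g₂ := θ) fun t => by rw [θ]; ring
  have h2 := h1.sub (orth_W.trans (ε_isBigO_θ (l := l) (m := m) (n := n) (p := p) (η := η)
    (ρ := ρ) hk))
  rw [isBigO_matrix] at h0 h2
  refine IsBigO.trans (isBigO_inv_of_tendsto (fun t => (t.gsvd.pos_s i).ne') ?_) (h0 i i)
  have h3 := ((h2 i i).trans_tendsto hθ).const_sub 1
  rw [sub_zero] at h3
  refine h3.congr fun t => ?_
  rw [Matrix.mul_sub, ← Matrix.mul_assoc t.BbarInv, t.inv_mul_Bbar, Matrix.one_mul,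
    ← Matrix.mul_assoc t.BbarInv, Matrix.mul_sub, ← Matrix.mul_assoc t.Wᵀ]
  simp

/-- As for `s_i`, with `B_k` and `P` cut down to their first `k` rows to have an invertible matrix.
-/
theorem c_inv_isBigO (i : Fin k) :
    (fun t : Run m n p k η ρ => (t.c i)⁻¹) =O[l] fun t => t.κ := by
  have hP : (fun t : Run m n p k η ρ => t.P.submatrix Fin.castSucc id) =O[l] fun _ => (1 : ℝ) := by
    have := P_isBigO (l := l) (m := m) (n := n) (p := p) (k := k) (η := η) (ρ := ρ)
    rw [isBigO_matrix] at *
    exact fun i j => this i.castSucc j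
  have hB : (fun t : Run m n p k η ρ => t.X.Bunder k * t.W -
      t.P.submatrix Fin.castSucc id * diagonal t.c) =O[l] fun t => t.ε := by
    have := (B_gsvd hk hθ).1
    rw [isBigO_matrix] at *
    exact fun i j => this i.castSucc j
  have h0 := ((W_isBigO (l := l)).matrix_transpose.matrix_mul
    (Bunder_inv_isBigO.matrix_mul hP)).congr_right fun t => by
      rw [one_mul, mul_one]
  have h1 := ((W_isBigO.matrix_transpose.matrix_mul (Bunder_inv_isBigO.matrix_mul
    hB)).congr_right fun t => one_mul _).trans (κ_mul_ε_isBigO_θ hk)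
  have h2 := h1.sub (orth_W.trans (ε_isBigO_θ (l := l) (m := m) (n := n) (p := p) (η := η)
    (ρ := ρ) hk))
  rw [isBigO_matrix] at h0 h2
  refine IsBigO.trans (isBigO_inv_of_tendsto (fun t => (t.gsvd.pos_c i).ne') ?_) (h0 i i)
  have h3 := ((h2 i i).trans_tendsto hθ).const_sub 1
  rw [sub_zero] at h3
  refine h3.congr fun t => ?_
  rw [Matrix.mul_sub, ← Matrix.mul_assoc (t.X.Bunder k)⁻¹,
    nonsing_inv_mul _ t.noBreakdown.isUnit_det_Bunder, Matrix.one_mul,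
    ← Matrix.mul_assoc (t.X.Bunder k)⁻¹, Matrix.mul_sub, ← Matrix.mul_assoc t.Wᵀ]
  simp

theorem res₁_isBigO (i : Fin k) : (fun t : Run m n p k η ρ => t.res₁ i) =O[l] θ := by
  refine isBigO_col (f := fun t : Run m n p k η ρ =>
    t.QA * t.Vn * t.W - t.X.U k * (t.P * diagonal t.c)) ?_ i
  have h1 := (((QA_mul_Vn hk).matrix_mul W_isBigO).congr_right fun _ => mul_one _).trans
    (κ_mul_ε_isBigO_θ (l := l) (m := m) (n := n) (p := p) (η := η) (ρ := ρ) hk)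
  have h2 := ((U_isBigO.matrix_mul (B_gsvd hk hθ).1).congr_right fun _ => one_mul _).trans
    (ε_isBigO_θ hk)
  refine (h1.add h2).congr_left fun t => ?_
  simp only [Matrix.sub_mul, Matrix.mul_sub, Matrix.mul_assoc]
  abel

theorem res₂_isBigO (i : Fin k) : (fun t : Run m n p k η ρ => t.res₂ i) =O[l] θ := by
  refine isBigO_col (f := fun t : Run m n p k η ρ =>
    t.QL * t.Vn * t.W - t.X.Uhat k * (t.Pbar * diagonal t.s)) ?_ i
  have h1 := (((QL_mul_Vn hk hθ).matrix_mul W_isBigO).congr_right fun _ => mul_one _).trans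
    (κ_mul_ε_isBigO_θ hk)
  have h2 := ((Uhat_isBigO.matrix_mul (Bbar_gsvd hk hθ).1).congr_right fun _ => one_mul _).trans
    (κ_mul_ε_isBigO_θ hk)
  refine (h1.add h2).congr_left fun t => ?_
  simp only [Matrix.sub_mul, Matrix.mul_sub, Matrix.mul_assoc]
  abel

end Small

/-- The quantity in the first residual bound. -/
def coef (hk : 1 ≤ k) (t : Run m n p k η ρ) (i : Fin k) : ℝ :=
  t.s i * t.X.α (k + 1) * t.P (Fin.last k) i -
    t.c i * t.X.βbar k * t.Pbar (lastIdx hk) i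

/-- The quantity in the second residual bound. -/
def coef' (hk : 1 ≤ k) (t : Run m n p k η ρ) (i : Fin k) : ℝ :=
  t.X.α (k + 1) * t.X.β (k + 1) / (t.c i * t.s i) * t.W (lastIdx hk) i

section Small

variable (hk : 1 ≤ k) (hθ : Tendsto (fun t : Run m n p k η ρ => t.θ) l (𝓝 0))

include hθ

/-- Inserting the relations for `Q_Aᵀ U` and `Q_Lᵀ Û`, the two main terms `V Bᵀ P Ψ` and `V B̄ᵀ P̄
Θ` both become `V W Θ Ψ` and cancel. Only the rank-one terms remain. -/
theorem res₃_sub_isBigO (i : Fin k) :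
    (fun t : Run m n p k η ρ => t.res₃ i - t.coef hk i • t.q) =O[l] θ := by
  have hs := isBigO_diagonal (s_isBigO hk hθ)
  have hc := isBigO_diagonal (c_isBigO hk hθ)
  have a1 := ((QA_transpose_mul_U.matrix_mul (P_isBigO.matrix_mul hs)).congr_right
    fun _ => by rw [mul_one, mul_one]).trans (ε_isBigO_θ hk)
  have a2 := ((QL_transpose_mul_Uhat hk hθ).matrix_mul
    ((Pbar_isBigO hk hθ).matrix_mul hc)).congr_right fun _ => by rw [mul_one, mul_one]
  have a3 := ((Vn_isBigO.matrix_mul ((B_gsvd hk hθ).2.matrix_mul hs)).congr_right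
    fun _ => by rw [mul_one, one_mul]).trans (ε_isBigO_θ hk)
  have a4 := ((Vn_isBigO.matrix_mul ((Bbar_gsvd hk hθ).2.matrix_mul hc)).congr_right
    fun _ => by rw [mul_one, one_mul]).trans (κ_mul_ε_isBigO_θ hk)
  refine (isBigO_col ((a1.sub a2).add (a3.sub a4)) i).congr_left fun t => ?_
  have hcs : diagonal t.c * diagonal t.s = diagonal t.s * diagonal t.c := by
    simp only [diagonal_mul_diagonal, mul_comm]
  have e : (t.QAᵀ * t.X.U k - (t.Vn * (t.X.B k)ᵀ +
        vecMulVec t.q (Pi.single (Fin.last k) (t.X.α (k + 1))))) * (t.P * diagonal t.s) -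
      (t.QLᵀ * t.X.Uhat k - (t.Vn * (t.X.Bbar k)ᵀ +
        vecMulVec t.q (Pi.single (lastIdx hk) (t.X.βbar k)))) * (t.Pbar * diagonal t.c) +
      (t.Vn * (((t.X.B k)ᵀ * t.P - t.W * diagonal t.c) * diagonal t.s) -
        t.Vn * (((t.X.Bbar k)ᵀ * t.Pbar - t.W * diagonal t.s) * diagonal t.c)) =
      (t.QAᵀ * t.X.U k * (t.P * diagonal t.s) - t.QLᵀ * t.X.Uhat k * (t.Pbar * diagonal t.c)) -
      (vecMulVec t.q (Pi.single (Fin.last k) (t.X.α (k + 1)) ᵥ* (t.P * diagonal t.s)) -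
        vecMulVec t.q (Pi.single (lastIdx hk) (t.X.βbar k) ᵥ*
          (t.Pbar * diagonal t.c))) := by
    simp only [Matrix.sub_mul, Matrix.mul_sub, Matrix.add_mul, Matrix.mul_assoc, hcs,
      vecMulVec_mul]
    abel
  rw [e, res₃]
  ext a
  simp only [col_apply, Matrix.sub_apply, Pi.sub_apply, vecMulVec_apply, single_vecMul,
    Pi.smul_apply, Matrix.row, mul_diagonal, smul_eq_mul, coef]
  ring

theorem coef_isBigO_one (i : Fin k) :
    (fun t : Run m n p k η ρ => t.coef hk i) =O[l] fun _ => (1 : ℝ) := by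
  have hP := isBigO_matrix.1 (P_isBigO (l := l) (m := m) (n := n) (p := p) (k := k) (η := η)
    (ρ := ρ)) (Fin.last k) i
  have hPb := isBigO_matrix.1 (Pbar_isBigO hk hθ) (lastIdx hk) i
  have h1 := ((s_isBigO hk hθ i).mul (α_isBigO (i := k + 1) (by omega) le_rfl)).mul hP
  have h2 := ((c_isBigO hk hθ i).mul ((βh_last_isBigO_one hk hθ).const_mul_left
    ((-1) ^ k))).mul hPb
  exact (h1.sub h2).congr_right fun _ => by ring

/-- Writing `1 ≈ c² + s²` in the numerator, `α β w / (c s)` becomes `s α (β w / c) + c (α β w / s)`.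
The last rows of the decompositions give `β w / c ≈ e_{k+1}ᵀ p` and `α̂ w / s ≈ ± e_kᵀ p̄`, and `α β
≈ α̂_k β̂_k`. -/
theorem coef_sub_coef'_isBigO (i : Fin k) :
    (fun t : Run m n p k η ρ => t.coef hk i - t.coef' hk i) =O[l] θ := by
  have hv := val_lastIdx hk
  have hP := isBigO_matrix.1 (P_isBigO (l := l) (m := m) (n := n) (p := p) (k := k) (η := η)
    (ρ := ρ)) (Fin.last k) i
  have hW := isBigO_matrix.1 (W_isBigO (l := l) (m := m) (n := n) (p := p) (k := k) (η := η)
    (ρ := ρ)) (lastIdx hk) i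
  have hα := α_isBigO (l := l) (m := m) (n := n) (p := p) (k := k) (η := η)
    (ρ := ρ) (i := k + 1) (by omega) le_rfl
  have hs := s_isBigO hk hθ i
  have hc := c_isBigO hk hθ i
  have hs' := s_inv_isBigO hk hθ i
  have hc' := c_inv_isBigO hk hθ i
  have hβ := (βh_last_isBigO_one hk hθ).const_mul_left ((-1) ^ k)
  have e1 := isBigO_matrix.1 (B_gsvd hk hθ).1 (Fin.last k) i
  have e2 := isBigO_matrix.1 (Bbar_gsvd hk hθ).1 (lastIdx hk) i
  have e3 := (βh_rec (l := l) (m := m) (n := n) (p := p) (η := η) (ρ := ρ) hk le_rfl).2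
  have e4 := sq_add_sq (l := l) (m := m) (n := n) (p := p) (η := η) (ρ := ρ) hk i
  have b1 := (((hs.mul hα).mul e1).mul hc').congr_right (g₂ := fun t => t.κ * t.ε)
    fun t => by ring
  have b2 := (((hc.mul e3).mul hW).mul hs').congr_right (g₂ := fun t => t.κh * t.ε)
    fun t => by ring
  have b3 := (((hc.mul hβ).mul e2).mul hs').congr_right (g₂ := θ) fun t => by rw [θ]; ring
  -- Bounding the defect of `c² + s² = 1` directly against `1 / (c s)` would give `κ² κ̂ ε`.
  -- Replacing `β w` by `c p` plus an error first cancels `1 / c` in the main part, and the rest,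
  -- treated next, is of second order.
  have b4 := (((e4.mul hα).mul hP).mul hs').congr_right (g₂ := θ) fun t => by rw [θ]; ring
  have b5 := ((((e4.mul hα).mul e1).mul hc').mul hs').congr_right
    (g₂ := fun t => (t.κ * t.ε) * t.θ) fun t => by rw [θ]; ring
  have b5' := b5.trans (((((κ_mul_ε_isBigO_θ hk).trans (hθ.isBigO_one ℝ)).mul
    (isBigO_refl θ l))).congr_right fun _ => one_mul _)
  refine (((((b1.trans (κ_mul_ε_isBigO_θ hk)).neg_left.add
    (b2.trans (κh_mul_ε_isBigO_θ hk))).add b3).add b4).add b5').congr_left fun t => ?_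
  have r1 : (t.X.B k * t.W) (Fin.last k) i = t.X.β (k + 1) * t.W (lastIdx hk) i := by
    rw [Matrix.mul_apply, Finset.sum_eq_single (lastIdx hk)]
    · simp only [Data.B, Fin.val_last]
      rw [if_neg (by omega), if_pos (by omega), show (lastIdx hk : ℕ) + 2 = k + 1 by omega]
    · intro j _ hj
      have : (j : ℕ) ≠ k - 1 := fun h => hj (Fin.ext h)
      simp only [Data.B, Fin.val_last]
      rw [if_neg (by omega), if_neg (by omega), zero_mul]
    · simp
  have r2 : (t.X.Bbar k * t.W) (lastIdx hk) i =
      -(-1) ^ k * t.X.αh k * t.W (lastIdx hk) i := by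
    rw [Matrix.mul_apply, Finset.sum_eq_single (lastIdx hk)]
    · rw [Data.Bbar, mul_diagonal]
      simp only [Data.Bhat, if_true]
      rw [show (lastIdx hk : ℕ) + 1 = k by omega, hv]
      have e3 : (-1 : ℝ) ^ k = - (-1) ^ (k - 1) := by
        obtain ⟨k', rfl⟩ : ∃ k', k = k' + 1 := ⟨k - 1, by omega⟩
        simp [pow_succ]
      rw [e3]
      ring
    · intro j _ hj
      have : (j : ℕ) ≠ k - 1 := fun h => hj (Fin.ext h)
      rw [Data.Bbar, mul_diagonal]
      simp only [Data.Bhat]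
      rw [if_neg (by omega), if_neg (by omega), zero_mul, zero_mul]
    · simp
  rw [Matrix.sub_apply, Matrix.sub_apply, r1, r2, mul_diagonal, mul_diagonal, coef, coef',
    Data.βbar]
  have hs0 := (t.gsvd.pos_s i).ne'
  have hc0 := (t.gsvd.pos_c i).ne'
  have e : ((-1 : ℝ) ^ k) ^ 2 = 1 := by rw [← pow_mul, mul_comm, pow_mul]; simp
  generalize (-1 : ℝ) ^ k = σ at *
  field_simp
  linear_combination (-(t.c i) ^ 2 * t.X.βh k * t.X.αh k * t.W (lastIdx hk) i) * e

end Small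

end Run

/-! ### From estimates of the blocks to the residual bounds -/

theorem norm_toLp_elim_le {ι κ τ : Type*} [Fintype ι] [Fintype κ] [Fintype τ]
    (a : ι → ℝ) (b : κ → ℝ) (c : τ → ℝ) :
    ‖WithLp.toLp 2 (Sum.elim a (Sum.elim b c))‖ ≤
      ‖WithLp.toLp 2 a‖ + ‖WithLp.toLp 2 b‖ + ‖WithLp.toLp 2 c‖ := by
  refine le_of_sq_le_sq_of_nonneg ?_ (by positivity)
  have h : ‖WithLp.toLp 2 (Sum.elim a (Sum.elim b c))‖ ^ 2 =
      ‖WithLp.toLp 2 a‖ ^ 2 + ‖WithLp.toLp 2 b‖ ^ 2 + ‖WithLp.toLp 2 c‖ ^ 2 := by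
    simp only [norm_toLp_sq, Fintype.sum_sum_type, Sum.elim_inl, Sum.elim_inr]
    ring
  rw [h]
  have ha := norm_nonneg (WithLp.toLp 2 a)
  have hb := norm_nonneg (WithLp.toLp 2 b)
  have hc := norm_nonneg (WithLp.toLp 2 c)
  nlinarith [mul_nonneg ha hb, mul_nonneg ha hc, mul_nonneg hb hc]

namespace Run

variable {m n p k : ℕ} {η ρ : ℝ}

/-- The norm of the residual. -/
def resNorm (t : Run m n p k η ρ) (i : Fin k) : ℝ :=
  ‖WithLp.toLp 2 (jbdResidual t.A t.L t.Q t.R t.X k (t.c i) (t.s i) (t.W.col i) (t.P.col i)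
    (t.Pbar.col i))‖

/-- Only the third block carries `Rᵀ`; the others acquire the factor `‖R‖` through `1 ≤ ‖R‖ / ρ`. -/
theorem resNorm_le (hρ : 0 < ρ) (t : Run m n p k η ρ) (i : Fin k) : t.resNorm i ≤
    ‖t.R‖ * ((‖WithLp.toLp 2 (t.res₁ i)‖ + ‖WithLp.toLp 2 (t.res₂ i)‖) / ρ +
      ‖WithLp.toLp 2 (t.res₃ i)‖) := by
  rw [resNorm, jbdResidual_eq]
  refine (norm_toLp_elim_le _ _ _).trans ?_
  have h1 := norm_toLp_mulVec_le t.Rᵀ (t.res₃ i)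
  rw [l2_opNorm_transpose] at h1
  have h2 : ‖WithLp.toLp 2 (t.res₁ i)‖ + ‖WithLp.toLp 2 (t.res₂ i)‖ ≤
      ‖t.R‖ * ((‖WithLp.toLp 2 (t.res₁ i)‖ + ‖WithLp.toLp 2 (t.res₂ i)‖) / ρ) := by
    rw [← mul_div_assoc, le_div_iff₀ hρ, mul_comm]
    exact mul_le_mul_of_nonneg_right t.le_norm_R (by positivity)
  rw [mul_add]
  linarith

theorem norm_q_le (hk : 1 ≤ k) : ∃ K : ℝ, 0 < K ∧ ∀ t : Run m n p k η ρ,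
    ‖WithLp.toLp 2 t.q‖ ≤ 1 + K * t.ε := by
  obtain ⟨K, hK, H⟩ := FlNormalize.bounds (Fin m ⊕ Fin p)
  refine ⟨K, hK, fun t => ?_⟩
  obtain ⟨g, r, -, -, hn⟩ := t.computed.v_step k hk le_rfl
  exact (t.qr.norm_transpose_mulVec_le _).trans (H t.ε t.ε_pos t.ε_le _ _ _ hn).2.2.1

/-- The residual bounds where `κ κ̂ ε` is small. -/
theorem resNorm_le_of_small (hk : 1 ≤ k) (hρ : 0 < ρ) (i : Fin k) :
    ∃ C δ : ℝ, 0 < C ∧ 0 < δ ∧ ∀ t : Run m n p k η ρ, t.θ < δ →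
      t.resNorm i ≤ ‖t.R‖ * (|t.coef hk i| + C * t.θ) ∧
      t.resNorm i ≤ ‖t.R‖ * (|t.coef' hk i| + C * t.θ) := by
  -- This filter has the sets `|θ| < δ` as a basis, so eventual bounds along it are uniform bounds
  -- on all runs with small `θ`.
  have hθ : Tendsto (fun t : Run m n p k η ρ => t.θ) (comap θ (𝓝 0)) (𝓝 0) := tendsto_comap
  obtain ⟨C₁, hC₁, h1⟩ := ((isBigO_toLp _).trans (res₁_isBigO hk hθ i)).exists_pos
  obtain ⟨C₂, hC₂, h2⟩ := ((isBigO_toLp _).trans (res₂_isBigO hk hθ i)).exists_pos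
  obtain ⟨C₃, hC₃, h3⟩ := ((isBigO_toLp _).trans (res₃_sub_isBigO hk hθ i)).exists_pos
  obtain ⟨C₄, hC₄, h4⟩ := (((coef_isBigO_one hk hθ i).mul (ε_isBigO_θ hk)).congr_right
    fun _ => one_mul _).exists_pos
  obtain ⟨C₅, hC₅, h5⟩ := (coef_sub_coef'_isBigO hk hθ i).exists_pos
  obtain ⟨K, hK, hq⟩ := norm_q_le (m := m) (n := n) (p := p) (η := η) (ρ := ρ) hk
  have hev := h1.bound.and (h2.bound.and (h3.bound.and (h4.bound.and h5.bound)))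
  obtain ⟨δ, hδ, hδ'⟩ := ((Metric.nhds_basis_ball (x := (0 : ℝ))).comap
    (θ : Run m n p k η ρ → ℝ)).eventually_iff.1 hev
  refine ⟨(C₁ + C₂) / ρ + C₃ + K * C₄ + C₅, δ, by positivity, hδ, fun t ht => ?_⟩
  have ht0 := t.θ_nonneg
  obtain ⟨b1, b2, b3, b4, b5⟩ := hδ' (x := t) (by
    simpa [abs_of_nonneg ht0] using ht)
  rw [Real.norm_of_nonneg ht0] at b1 b2 b3 b4 b5
  rw [norm_mul, Real.norm_eq_abs, Real.norm_of_nonneg t.ε_pos.le] at b4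
  rw [Real.norm_eq_abs] at b5
  have b6 : ‖WithLp.toLp 2 (t.res₃ i)‖ ≤ |t.coef hk i| + (C₃ + K * C₄) * t.θ := by
    calc ‖WithLp.toLp 2 (t.res₃ i)‖
        = ‖WithLp.toLp 2 (t.res₃ i - t.coef hk i • t.q) +
            t.coef hk i • WithLp.toLp 2 t.q‖ := by
          rw [← WithLp.toLp_smul, ← WithLp.toLp_add, sub_add_cancel]
      _ ≤ C₃ * t.θ + |t.coef hk i| * (1 + K * t.ε) := by
          refine (norm_add_le _ _).trans (add_le_add b3 ?_)
          rw [norm_smul, Real.norm_eq_abs]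
          exact mul_le_mul_of_nonneg_left (hq t) (abs_nonneg _)
      -- The excess `K ε` in `‖q‖ ≤ 1 + K ε` is absorbed because the coefficient is bounded and `ε =
      -- O(θ)`.
      _ ≤ _ := by nlinarith
  have b7 : (‖WithLp.toLp 2 (t.res₁ i)‖ + ‖WithLp.toLp 2 (t.res₂ i)‖) / ρ ≤
      (C₁ + C₂) / ρ * t.θ := by
    rw [div_mul_eq_mul_div]
    exact div_le_div_of_nonneg_right (by linarith) hρ.le
  have b8 : |t.coef hk i| ≤ |t.coef' hk i| + C₅ * t.θ := by
    have := abs_sub_abs_le_abs_sub (t.coef hk i) (t.coef' hk i)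
    linarith
  have b9 : 0 ≤ C₅ * t.θ := by positivity
  constructor <;>
    refine (t.resNorm_le hρ i).trans (mul_le_mul_of_nonneg_left ?_ (norm_nonneg _)) <;>
    linarith

/-- The residual bounds where `κ κ̂ ε` is not small. -/
theorem resNorm_le_of_large (hk : 1 ≤ k) (hρ : 0 < ρ) (i : Fin k) {δ : ℝ} (hδ : 0 < δ) :
    ∃ C : ℝ, 0 < C ∧ ∀ t : Run m n p k η ρ, δ ≤ t.θ → t.resNorm i ≤ ‖t.R‖ * (C * t.θ) := by
  -- Along `⊤` an `O` estimate holds for every run.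
  obtain ⟨C₁, hC₁, h1⟩ := ((isBigO_toLp _).trans (res₁_isBigO_N (l := ⊤) (m := m) (n := n) (p := p)
    (η := η) (ρ := ρ) hk i)).exists_pos
  obtain ⟨C₂, hC₂, h2⟩ := ((isBigO_toLp _).trans (res₂_isBigO_N (l := ⊤) (m := m) (n := n) (p := p)
    (η := η) (ρ := ρ) hk i)).exists_pos
  obtain ⟨C₃, hC₃, h3⟩ := ((isBigO_toLp _).trans (res₃_isBigO_N (l := ⊤) (m := m) (n := n) (p := p)
    (η := η) (ρ := ρ) hk i)).exists_pos
  obtain ⟨C₄, hC₄, h4⟩ := (κ_mul_ε_isBigO_θ (l := ⊤) (m := m) (n := n) (p := p)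
    (η := η) (ρ := ρ) hk).exists_pos
  have b1 := eventually_top.1 h1.bound
  have b2 := eventually_top.1 h2.bound
  have b3 := eventually_top.1 h3.bound
  have b4 := eventually_top.1 h4.bound
  refine ⟨((C₁ + C₂) / ρ + C₃) * (1 / δ + C₄), by positivity, fun t ht => ?_⟩
  have ht0 := t.θ_nonneg
  have hN0 : 0 ≤ t.N := add_nonneg zero_le_one t.κ_mul_ε_nonneg
  have hN : t.N ≤ (1 / δ + C₄) * t.θ := by
    have h5 := b4 t
    rw [Real.norm_of_nonneg ht0, Real.norm_of_nonneg t.κ_mul_ε_nonneg] at h5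
    have h6 : 1 ≤ 1 / δ * t.θ := by rw [div_mul_eq_mul_div, one_mul, one_le_div hδ]; exact ht
    rw [N, add_mul]
    linarith
  have c1 := b1 t
  have c2 := b2 t
  have c3 := b3 t
  rw [Real.norm_of_nonneg hN0] at c1 c2 c3
  refine (t.resNorm_le hρ i).trans ?_
  gcongr
  calc _ ≤ (C₁ * t.N + C₂ * t.N) / ρ + C₃ * t.N := by gcongr
    _ = ((C₁ + C₂) / ρ + C₃) * t.N := by ring
    _ ≤ ((C₁ + C₂) / ρ + C₃) * ((1 / δ + C₄) * t.θ) := by gcongr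
    _ = _ := by ring

theorem resNorm_le_coef (hk : 1 ≤ k) (hρ : 0 < ρ) (i : Fin k) :
    ∃ C : ℝ, 0 < C ∧ ∀ t : Run m n p k η ρ,
      t.resNorm i ≤ ‖t.R‖ * (|t.coef hk i| + C * t.θ) ∧
      t.resNorm i ≤ ‖t.R‖ * (|t.coef' hk i| + C * t.θ) := by
  obtain ⟨C, δ, hC, hδ, hsmall⟩ :=
    resNorm_le_of_small (m := m) (n := n) (p := p) (η := η) hk hρ i
  obtain ⟨C', hC', hlarge⟩ :=
    resNorm_le_of_large (m := m) (n := n) (p := p) (η := η) hk hρ i hδ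
  refine ⟨C + C', by positivity, fun t => ?_⟩
  have ht0 := t.θ_nonneg
  have h1 : 0 ≤ C * t.θ := by positivity
  have h2 : 0 ≤ C' * t.θ := by positivity
  rcases lt_or_ge t.θ δ with h | h
  · obtain ⟨h3, h4⟩ := hsmall t h
    exact ⟨h3.trans (by gcongr; linarith), h4.trans (by gcongr; linarith)⟩
  · have h3 := hlarge t h
    have h4 := abs_nonneg (t.coef hk i)
    have h5 := abs_nonneg (t.coef' hk i)
    exact ⟨h3.trans (by gcongr; linarith), h3.trans (by gcongr; linarith)⟩

end Run

end JBD

end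

theorem mainTheorem3 (m n p k : ℕ) (hk : 1 ≤ k) (η ρ : ℝ) (hη : 0 ≤ η) (hρ : 0 < ρ) :
    ∃ C : ℝ, 0 < C ∧
      ∀ (ε : ℝ), 0 < ε → ε ≤ 1 / 2 →
      ∀ (A : Matrix (Fin m) (Fin n) ℝ) (L : Matrix (Fin p) (Fin n) ℝ)
        (Q : Matrix (Fin m ⊕ Fin p) (Fin n) ℝ) (R : Matrix (Fin n) (Fin n) ℝ),
        JBD.IsRegularQR A L Q R → ρ ≤ ‖R‖ →
      ∀ (X : JBD.Data m p), JBD.IsComputed A L k η ε X → X.NoBreakdown k →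
      ∀ (c s : Fin k → ℝ) (P : Matrix (Fin (k + 1)) (Fin k) ℝ) (Pbar W : Matrix (Fin k) (Fin k) ℝ),
        JBD.IsComputedGSVD (X.B k) (X.Bbar k) (η * ε) (η * ((1 + ‖(X.Bunder k)⁻¹‖) * ε))
          c s P Pbar W →
      ∀ i : Fin k,
        ‖WithLp.toLp 2
            (JBD.jbdResidual A L Q R X k (c i) (s i) (W.col i) (P.col i) (Pbar.col i))‖ ≤
          ‖R‖ * (|s i * X.α (k + 1) * P (Fin.last k) i
                  - c i * X.βbar k * Pbar ⟨k - 1, by omega⟩ i|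
                + C * (‖(X.Bunder k)⁻¹‖ * ‖(X.Bhat k)⁻¹‖ * ε)) ∧
        ‖WithLp.toLp 2
            (JBD.jbdResidual A L Q R X k (c i) (s i) (W.col i) (P.col i) (Pbar.col i))‖ ≤
          ‖R‖ * (|X.α (k + 1) * X.β (k + 1) / (c i * s i) * W ⟨k - 1, by omega⟩ i|
                + C * (‖(X.Bunder k)⁻¹‖ * ‖(X.Bhat k)⁻¹‖ * ε)) := by
  choose C hC H using fun i : Fin k =>
    JBD.Run.resNorm_le_coef (m := m) (n := n) (p := p) (η := η) hk hρ i
  -- The sum of the constants for the individual components serves all of them at once.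
  refine ⟨∑ i, C i, Finset.sum_pos (fun i _ => hC i) ⟨⟨0, hk⟩, Finset.mem_univ _⟩, ?_⟩
  intro ε hε hε' A L Q R hqr hR X hX hnb c s P Pbar W hsvd i
  have hCi : C i ≤ ∑ i, C i :=
    Finset.single_le_sum (fun j _ => (hC j).le) (Finset.mem_univ i)
  obtain ⟨h1, h2⟩ := H i
    { ε := ε, A := A, L := L, Q := Q, R := R, X := X, c := c, s := s, P := P, Pbar := Pbar, W := W,
      ε_pos := hε, ε_le := hε', qr := hqr, le_norm_R := hR, computed := hX, noBreakdown := hnb,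
      gsvd := hsvd }
  have hθ : 0 ≤ ‖(X.Bunder k)⁻¹‖ * ‖(X.Bhat k)⁻¹‖ * ε := by positivity
  exact ⟨h1.trans (mul_le_mul_of_nonneg_left
      (add_le_add le_rfl (mul_le_mul_of_nonneg_right hCi hθ)) (norm_nonneg _)),
    h2.trans (mul_le_mul_of_nonneg_left
      (add_le_add le_rfl (mul_le_mul_of_nonneg_right hCi hθ)) (norm_nonneg _))⟩
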